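/- Let $\Delta$ be a triangulation of a region in the plane, i.e. a finite straight-line simplicial complex in $\mathbb{R}^2$ whose union is the closure of a nonempty connected open set. Let $G_\Delta$ be its dual graph, considered as a plane graph: it has one vertex for each triangle of $\Delta$ (drawn at its barycentre), and an edge between two vertices whenever the two triangles share an edge of $\Delta$ (drawn as a polygonal arc through the midpoint of the shared edge). Let $e$ be the number of edges of $G_\Delta$ and let $f$ be the number of its bounded faces, i.e. of the bounded connected components of the complement of $G_\Delta$ in the plane. Suppose that $G_\Delta$ is contractible, meaning that $e-3f\leqslant 0$. Then $\Delta$ is a subdivided triangle: there are three affinely independent points $a,b,c$ such that the boundary edges of $\Delta$ (the edges lying on exactly one triangle of $\Delta$) are precisely $ab$, $bc$, $ca$, and the union of $\Delta$ is the triangle with vertices $a,b,c$. -/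

import Mathlib

namespace PlanarTriangulation

open Geometry

/-- The Euclidean plane. -/
abbrev Plane : Type := EuclideanSpace ℝ (Fin 2)

/-- `Δ` is a (finite, straight-line) triangulation of the compact plane region `closure Ω`, where
`Ω` is a nonempty connected open subset of the plane. -/
structure IsTriangulationOf (Δ : SimplicialComplex ℝ Plane) (Ω : Set Plane) : Prop where
  isOpen : IsOpen Ω
  isConnected : IsConnected Ω
  finite_faces : Δ.faces.Finite
  space_eq : Δ.space = closure Ω

/-- The triangles of `Δ`. -/
def triangles (Δ : SimplicialComplex ℝ Plane) : Set (Finset Plane) :=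
  {t | t ∈ Δ.faces ∧ t.card = 3}

/-- The edges of `Δ`. -/
def edges (Δ : SimplicialComplex ℝ Plane) : Set (Finset Plane) :=
  {e | e ∈ Δ.faces ∧ e.card = 2}

/-- The boundary edges of `Δ`: the edges that lie on exactly one triangle. -/
def boundaryEdges (Δ : SimplicialComplex ℝ Plane) : Set (Finset Plane) :=
  {e | e ∈ edges Δ ∧ ∃! t, t ∈ triangles Δ ∧ e ⊆ t}

/-- The dual graph `G_Δ`: one vertex for every triangle of `Δ`, two vertices being joined when the
triangles share an edge of `Δ`. (Two distinct triangles share at most one edge, so that this is a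
simple graph.) -/
def dualGraph (Δ : SimplicialComplex ℝ Plane) : SimpleGraph (triangles Δ) where
  Adj s t := s ≠ t ∧ ∃ e ∈ edges Δ, e ⊆ s.1 ∧ e ⊆ t.1
  symm := ⟨fun _ _ h => ⟨h.1.symm, h.2.imp fun _ he => ⟨he.1, he.2.2, he.2.1⟩⟩⟩
  loopless := ⟨fun _ h => h.1 rfl⟩

/-- The barycentre of a simplex; for an edge this is its midpoint. -/
noncomputable def barycenter (s : Finset Plane) : Plane :=
  (s.card : ℝ)⁻¹ • ∑ x ∈ s, x

/-- The dual graph as a plane graph, that is, the subset of the plane which is its drawing: the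
vertex dual to a triangle is the barycentre of the triangle, and the edge between the triangles `s`
and `t` that share the edge `e` is the polygonal arc from the barycentre of `s` through the
midpoint of `e` to the barycentre of `t`. -/
def dualDrawing (Δ : SimplicialComplex ℝ Plane) : Set Plane :=
  {p | ∃ t ∈ triangles Δ, p = barycenter t} ∪
  {p | ∃ s ∈ triangles Δ, ∃ t ∈ triangles Δ, ∃ e ∈ edges Δ, s ≠ t ∧ e ⊆ s ∧ e ⊆ t ∧
    p ∈ segment ℝ (barycenter s) (barycenter e) ∪ segment ℝ (barycenter e) (barycenter t)}

/-- The bounded faces of the plane graph `G_Δ`: the bounded connected components of the complement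
of its drawing. -/
def dualBoundedFaces (Δ : SimplicialComplex ℝ Plane) : Set (Set Plane) :=
  {F | Bornology.IsBounded F ∧
    ∃ p ∈ (dualDrawing Δ)ᶜ, F = connectedComponentIn (dualDrawing Δ)ᶜ p}

/-- `G_Δ` is contractible: `e - 3 f ≤ 0`, where `e` is the number of its edges and `f` the number
of its bounded faces. -/
def DualContractible (Δ : SimplicialComplex ℝ Plane) : Prop :=
  ((dualGraph Δ).edgeSet.ncard : ℤ) - 3 * ((dualBoundedFaces Δ).ncard : ℤ) ≤ 0

/-- `Δ` is a subdivided triangle: its boundary is a triangle `abc` (the boundary edges are exactly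
the three edges `ab`, `bc`, `ca`), and `Δ` subdivides this triangle. -/
def IsSubdividedTriangle (Δ : SimplicialComplex ℝ Plane) : Prop :=
  ∃ a b c : Plane, AffineIndependent ℝ ![a, b, c] ∧
    (∀ e : Finset Plane, e ∈ boundaryEdges Δ ↔
      (e : Set Plane) = {a, b} ∨ (e : Set Plane) = {b, c} ∨ (e : Set Plane) = {c, a}) ∧
    Δ.space = convexHull ℝ {a, b, c}

end PlanarTriangulation

namespace PlanarTriangulation

open Geometry Set Filter Topology

/-! ### Barycentric weights -/

section Weights

variable {E : Type*} [AddCommGroup E] [Module ℝ E]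

/-! Let T, I, B be the numbers of triangles, inner edges and boundary edges. Counting sides of
triangles gives 3T = B + 2I. One half of Euler's formula for the dual graph, f + T ≤ I + 1, together
with I ≤ e ≤ 3f, then yields B ≤ 3. Every vertex lies on an even number of boundary edges and B > 0,
so the boundary edges are the three sides of a triangle (`exists_boundary_triangle`).

The Euler inequality (`ncard_faces_add_ncard_triangles_le`) is linear algebra over `ZMod 2`. A
function on the bounded faces, extended by 0, gives a value at each vertex of Δ. Its differences
along inner edges lie in the kernel of the triangle/inner-edge incidence matrix, and this map is
injective. Connectedness of the dual graph gives that matrix rank at least T - 1, so f ≤ I - (T -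
1). The geometric input is that every face of the drawing contains a vertex, that the ends of a
boundary edge share a face, and that some vertex lies in an unbounded face. All three use that the
largest barycentric coordinate is attained twice at each point of the drawing.

Finally, a connected open set that avoids the boundary edges and meets Δ lies in Δ
(`subset_space_of_disjoint_boundaryEdges`). Applied to half planes it puts Δ inside the boundary
triangle, and applied to the interior of that triangle it gives the reverse inclusion. -/

/-- `w` is a system of barycentric weights of the point `p` with respect to the simplex `s`. -/
structure IsBary (s : Finset E) (w : E → ℝ) (p : E) : Prop where
  nonneg : ∀ x, 0 ≤ w x
  eq_zero : ∀ x, x ∉ s → w x = 0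
  sum_eq_one : ∑ x ∈ s, w x = 1
  sum_smul : ∑ x ∈ s, w x • x = p

theorem exists_isBary {s : Finset E} {p : E} (hp : p ∈ convexHull ℝ (s : Set E)) :
    ∃ w, IsBary s w p := by
  classical
  obtain ⟨w, h0, h1, h2⟩ := Finset.mem_convexHull'.1 hp
  refine ⟨fun x => if x ∈ s then w x else 0, fun x => ?_, fun x hx => by simp [hx], ?_, ?_⟩
  · by_cases hx : x ∈ s <;> simp [hx, h0]
  · rw [← h1]
    exact Finset.sum_congr rfl fun x hx => by simp [hx]
  · rw [← h2]
    exact Finset.sum_congr rfl fun x hx => by simp [hx]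

namespace IsBary

variable {s t : Finset E} {w w' : E → ℝ} {p : E}

theorem mem_convexHull (h : IsBary s w p) : p ∈ convexHull ℝ (s : Set E) :=
  Finset.mem_convexHull'.2 ⟨w, fun x _ => h.nonneg x, h.sum_eq_one, h.sum_smul⟩

theorem mono (h : IsBary s w p) (hst : s ⊆ t) : IsBary t w p where
  nonneg := h.nonneg
  eq_zero x hx := h.eq_zero x fun hxs => hx (hst hxs)
  sum_eq_one := by
    rw [← h.sum_eq_one]
    exact (Finset.sum_subset hst fun x _ hx => h.eq_zero x hx).symm
  sum_smul := by
    rw [← h.sum_smul]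
    exact (Finset.sum_subset hst fun x _ hx => by rw [h.eq_zero x hx, zero_smul]).symm

theorem restrict (h : IsBary t w p) (hst : s ⊆ t) (h0 : ∀ x ∈ t, x ∉ s → w x = 0) :
    IsBary s w p where
  nonneg := h.nonneg
  eq_zero x hx := by
    by_cases hxt : x ∈ t
    · exact h0 x hxt hx
    · exact h.eq_zero x hxt
  sum_eq_one := by
    rw [← h.sum_eq_one]
    exact Finset.sum_subset hst h0
  sum_smul := by
    rw [← h.sum_smul]
    exact Finset.sum_subset hst fun x hx hxs => by rw [h0 x hx hxs, zero_smul]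

theorem eq_of_affineIndependent (hs : AffineIndependent ℝ ((↑) : s → E)) (h : IsBary s w p)
    (h' : IsBary s w' p) : w = w' := by
  have key := (affineIndependent_iff.1 hs) Finset.univ (fun x => w x - w' x)
    (by
      rw [Finset.sum_sub_distrib, Finset.sum_coe_sort s, Finset.sum_coe_sort s, h.sum_eq_one,
        h'.sum_eq_one, sub_self])
    (by
      simp_rw [sub_smul]
      rw [Finset.sum_sub_distrib, Finset.sum_coe_sort s (fun x => w x • x),
        Finset.sum_coe_sort s (fun x => w' x • x), h.sum_smul, h'.sum_smul, sub_self])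
  funext x
  by_cases hx : x ∈ s
  · exact sub_eq_zero.1 (key ⟨x, hx⟩ (Finset.mem_univ _))
  · rw [h.eq_zero x hx, h'.eq_zero x hx]

/-- The point lies in the hull of `s ∩ t`, and weights for that hull, extended by zero, serve both
simplices. Barycentric coordinates therefore depend on the point alone, which is why weights are
functions on the whole space. -/
theorem unique {Δ : SimplicialComplex ℝ E} (hs : s ∈ Δ.faces) (ht : t ∈ Δ.faces)
    (h : IsBary s w p) (h' : IsBary t w' p) : w = w' := by
  classical
  have hp := Δ.inter_subset_convexHull hs ht ⟨h.mem_convexHull, h'.mem_convexHull⟩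
  rw [← Finset.coe_inter] at hp
  obtain ⟨w'', h''⟩ := exists_isBary hp
  rw [h.eq_of_affineIndependent (Δ.indep hs) (h''.mono Finset.inter_subset_left),
    h'.eq_of_affineIndependent (Δ.indep ht) (h''.mono Finset.inter_subset_right)]

theorem combine {q : E} {a b : ℝ} (h : IsBary s w p) (h' : IsBary s w' q) (ha : 0 ≤ a)
    (hb : 0 ≤ b) (hab : a + b = 1) : IsBary s (fun x => a * w x + b * w' x) (a • p + b • q) where
  nonneg x := add_nonneg (mul_nonneg ha (h.nonneg x)) (mul_nonneg hb (h'.nonneg x))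
  eq_zero x hx := by rw [h.eq_zero x hx, h'.eq_zero x hx]; simp
  sum_eq_one := by
    rw [Finset.sum_add_distrib, ← Finset.mul_sum, ← Finset.mul_sum, h.sum_eq_one, h'.sum_eq_one]
    linarith
  sum_smul := by
    simp_rw [add_smul, mul_smul]
    rw [Finset.sum_add_distrib, ← Finset.smul_sum, ← Finset.smul_sum, h.sum_smul, h'.sum_smul]

end IsBary

theorem isBary_single [DecidableEq E] {s : Finset E} {v : E} (hv : v ∈ s) :
    IsBary s (fun x => if x = v then 1 else 0) v where
  nonneg x := by split_ifs <;> simp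
  eq_zero x hx := if_neg fun h : x = v => hx (h ▸ hv)
  sum_eq_one := by simp [hv]
  sum_smul := by simp [hv]

end Weights

theorem isBary_barycenter [DecidableEq Plane] {s : Finset Plane} (hs : s.Nonempty) :
    IsBary s (fun x => if x ∈ s then (s.card : ℝ)⁻¹ else 0) (barycenter s) where
  nonneg x := by split_ifs <;> simp
  eq_zero x hx := if_neg hx
  sum_eq_one := by
    rw [Finset.sum_congr rfl fun x hx => if_pos hx]
    simp [hs.ne_empty]
  sum_smul := by
    rw [barycenter, Finset.smul_sum]
    exact Finset.sum_congr rfl fun x hx => by rw [if_pos hx]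

/-! ### Oriented areas -/

/-- Twice the oriented area of the triangle `a b x`. -/
def cross (a b x : Plane) : ℝ := (b 0 - a 0) * (x 1 - a 1) - (b 1 - a 1) * (x 0 - a 0)

theorem continuous_cross (a b : Plane) : Continuous (cross a b) := by
  unfold cross
  fun_prop

theorem plane_ext {p q : Plane} (h0 : p 0 = q 0) (h1 : p 1 = q 1) : p = q := by
  ext i
  fin_cases i
  · exact h0
  · exact h1

theorem cross_comb {a b c d e : Plane} {α β γ : ℝ} (h : α + β + γ = 1) :
    cross d e (α • a + β • b + γ • c) = α * cross d e a + β * cross d e b + γ * cross d e c := by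
  obtain rfl : α = 1 - β - γ := by linarith
  simp only [cross, PiLp.add_apply, PiLp.smul_apply, smul_eq_mul]
  ring

theorem cross_left (a b : Plane) : cross a b a = 0 := by simp [cross]

theorem cross_right (a b : Plane) : cross a b b = 0 := by simp [cross]; ring

theorem cross_rotate (a b c : Plane) : cross b c a = cross a b c := by simp only [cross]; ring

theorem cross_rotate' (a b c : Plane) : cross c a b = cross a b c := by simp only [cross]; ring

theorem cross_add (a b c x : Plane) : cross b c x + cross c a x + cross a b x = cross a b c := by
  simp only [cross]; ring

theorem cross_smul (a b c x : Plane) :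
    cross b c x • a + cross c a x • b + cross a b x • c = cross a b c • x := by
  apply plane_ext <;> simp only [cross, PiLp.add_apply, PiLp.smul_apply, smul_eq_mul] <;> ring

/-- If the area vanished, `cross_add` and `cross_smul` would be an affine relation among the three
points for every `x`. Independence kills its coefficients, and two test points then force `b = c`.
-/
theorem cross_ne_zero {a b c : Plane} (h : AffineIndependent ℝ ![a, b, c]) : cross a b c ≠ 0 := by
  intro h0
  have key : ∀ x, cross b c x = 0 := fun x => by
    have := (affineIndependent_iff.1 h) Finset.univ ![cross b c x, cross c a x, cross a b x]
      (by simpa [Fin.sum_univ_three, h0] using cross_add a b c x)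
      (by simpa [Fin.sum_univ_three, h0] using cross_smul a b c x) 0 (Finset.mem_univ _)
    simpa using this
  have hbc : b = c := by
    have e0 := key (b + !₂[0, 1])
    have e1 := key (b + !₂[1, 0])
    simp [cross] at e0 e1
    exact plane_ext (by linarith) (by linarith)
  have := h.injective (a₁ := 1) (a₂ := 2) (by simpa using hbc)
  simp at this

theorem mem_convexHull_triple {a b c p : Plane} :
    p ∈ convexHull ℝ {a, b, c} ↔
      ∃ α β γ : ℝ, 0 ≤ α ∧ 0 ≤ β ∧ 0 ≤ γ ∧ α + β + γ = 1 ∧ α • a + β • b + γ • c = p := by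
  constructor
  · intro h
    rw [convexHull_insert (by simp)] at h
    obtain ⟨x, hx, y, hy, hp⟩ := mem_convexJoin.1 h
    rw [mem_singleton_iff] at hx
    subst hx
    rw [convexHull_pair] at hy
    obtain ⟨u, v, hu, hv, huv, rfl⟩ := hy
    obtain ⟨r, q, hr, hq, hrq, rfl⟩ := hp
    refine ⟨r, q * u, q * v, hr, by positivity, by positivity, ?_, ?_⟩
    · rw [add_assoc, ← mul_add, huv, mul_one, hrq]
    · rw [smul_add, smul_smul, smul_smul, add_assoc]
  · rintro ⟨α, β, γ, hα, hβ, hγ, h1, rfl⟩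
    have hc := convex_convexHull ℝ ({a, b, c} : Set Plane)
    have := hc.sum_mem (t := Finset.univ) (w := ![α, β, γ]) (z := ![a, b, c])
      (by intro i _; fin_cases i <;> simpa) (by simpa [Fin.sum_univ_three] using h1)
      (by intro i _; fin_cases i <;> exact subset_convexHull ℝ _ (by simp))
    simpa [Fin.sum_univ_three] using this

/-- The barycentric coordinates are quotients of oriented areas. Multiplying by the total area
instead of dividing covers both orientations at once. -/
theorem mem_convexHull_iff_cross {a b c p : Plane} (h : cross a b c ≠ 0) :
    p ∈ convexHull ℝ {a, b, c} ↔ 0 ≤ cross a b p * cross a b c ∧ 0 ≤ cross b c p * cross a b c ∧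
      0 ≤ cross c a p * cross a b c := by
  rw [mem_convexHull_triple]
  constructor
  · rintro ⟨α, β, γ, hα, hβ, hγ, h1, rfl⟩
    simp only [cross_comb h1, cross_left, cross_right, cross_rotate, mul_zero,
      zero_add, add_zero, mul_assoc]
    exact ⟨mul_nonneg hγ (mul_self_nonneg _), mul_nonneg hα (mul_self_nonneg _),
      mul_nonneg hβ (mul_self_nonneg _)⟩
  · rintro ⟨h1, h2, h3⟩
    have aux : ∀ x : ℝ, 0 ≤ x * cross a b c → 0 ≤ x / cross a b c := fun x hx => by
      have : x / cross a b c = x * cross a b c / (cross a b c * cross a b c) := by field_simp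
      rw [this]
      exact div_nonneg hx (mul_self_nonneg _)
    refine ⟨_, _, _, aux _ h2, aux _ h3, aux _ h1, ?_, ?_⟩
    · rw [← add_div, ← add_div, cross_add, div_self h]
    · have := congrArg (fun x => (cross a b c)⁻¹ • x) (cross_smul a b c p)
      simpa [smul_smul, h, div_eq_inv_mul] using this

/-- A point with positive barycentric coordinates is interior to the triangle. -/
theorem mem_interior_triangle {a b c : Plane} (h : cross a b c ≠ 0) {α β γ : ℝ} (hα : 0 < α)
    (hβ : 0 < β) (hγ : 0 < γ) (h1 : α + β + γ = 1) :
    α • a + β • b + γ • c ∈ interior (convexHull ℝ {a, b, c}) := by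
  have hD : 0 < cross a b c * cross a b c := mul_self_pos.2 h
  have ev : ∀ d e : Plane, 0 < cross d e (α • a + β • b + γ • c) * cross a b c →
      ∀ᶠ x in 𝓝 (α • a + β • b + γ • c), 0 ≤ cross d e x * cross a b c := fun d e hp =>
    (((continuous_cross d e).mul continuous_const).continuousAt.eventually_const_lt hp).mono
      fun _ hx => hx.le
  rw [mem_interior_iff_mem_nhds]
  filter_upwards [ev a b (by
      simp only [cross_comb h1, cross_left, cross_right, mul_zero, zero_add, mul_assoc]
      positivity), ev b c (by
      simp only [cross_comb h1, cross_left, cross_right, cross_rotate, mul_zero, add_zero,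
        mul_assoc]
      positivity), ev c a (by
      simp only [cross_comb h1, cross_left, cross_right, cross_rotate' a b c, mul_zero, zero_add,
        add_zero, mul_assoc]
      positivity)] with x h1 h2 h3
  exact (mem_convexHull_iff_cross h).2 ⟨h1, h2, h3⟩

/-- Near an inner point of the side `a b`, the triangle `a b c` fills a half plane. -/
theorem eventually_mem_triangle {a b c : Plane} (h : cross a b c ≠ 0) {α β : ℝ} (hα : 0 < α)
    (hβ : 0 < β) (h1 : α + β = 1) :
    ∀ᶠ x in 𝓝 (α • a + β • b), 0 ≤ cross a b x * cross a b c → x ∈ convexHull ℝ {a, b, c} := by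
  have hD : 0 < cross a b c * cross a b c := mul_self_pos.2 h
  have h1' : α + β + 0 = 1 := by rw [add_zero, h1]
  have e : α • a + β • b = α • a + β • b + (0 : ℝ) • c := by simp
  rw [e]
  -- The conditions for the sides `b c` and `c a` are strict at an inner point of `a b`, so they
  -- persist nearby; only the condition for `a b` remains.
  have ev : ∀ d e : Plane, 0 < cross d e (α • a + β • b + (0 : ℝ) • c) * cross a b c →
      ∀ᶠ x in 𝓝 (α • a + β • b + (0 : ℝ) • c), 0 ≤ cross d e x * cross a b c := fun d e hp =>
    (((continuous_cross d e).mul continuous_const).continuousAt.eventually_const_lt hp).mono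
      fun _ hx => hx.le
  filter_upwards [ev b c (by
      simp only [cross_comb h1', cross_left, cross_right, cross_rotate, mul_zero, add_zero,
        mul_assoc]
      positivity), ev c a (by
      simp only [cross_comb h1', cross_left, cross_right, cross_rotate' a b c, mul_zero, zero_add,
        add_zero, mul_assoc]
      positivity)] with x h2 h3 h4
  exact (mem_convexHull_iff_cross h).2 ⟨h4, h2, h3⟩

/-! ### Open connected sets minus a countable set -/

section Connected

variable {E : Type*} [NormedAddCommGroup E] [InnerProductSpace ℝ E]

/-- The ball is homeomorphic to the whole space, where the complement of a countable set is
connected in dimension above one. -/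
theorem isPreconnected_ball_diff_countable (h : 1 < Module.rank ℝ E) {V : Set E}
    (hV : V.Countable) (x : E) {r : ℝ} (hr : 0 < r) :
    IsPreconnected (Metric.ball x r \ V) := by
  set φ := OpenPartialHomeomorph.univBall x r
  have hsrc : φ.source = univ := OpenPartialHomeomorph.univBall_source x r
  have htgt : φ.target = Metric.ball x r := OpenPartialHomeomorph.univBall_target x hr
  have hinj : Function.Injective φ := fun a b hab => φ.injOn (by simp [hsrc]) (by simp [hsrc]) hab
  have hcont : Continuous φ := OpenPartialHomeomorph.continuous_univBall x r
  have hc := ((hV.preimage hinj).isConnected_compl_of_one_lt_rank h).isPreconnected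
  have himg : φ '' (φ ⁻¹' V)ᶜ = Metric.ball x r \ V := by
    rw [← preimage_compl, image_preimage_eq_inter_range, inter_comm, ← image_univ, ← hsrc,
      φ.image_source_eq_target, htgt, sdiff_eq]
  exact himg ▸ hc.image φ hcont.continuousOn

theorem isPreconnected_diff_countable (h : 1 < Module.rank ℝ E) {U V : Set E}
    (hU : IsOpen U) (hc : IsPreconnected U) (hV : V.Countable) : IsPreconnected (U \ V) := by
  have : Nontrivial E := rank_pos_iff_nontrivial.1 (zero_lt_one.trans h)
  rw [isPreconnected_iff_subset_of_disjoint]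
  intro A B hA hB hAB hd
  -- A separation of `U \ V` is thickened to one of `U`: around each point of `U` a punctured ball
  -- is connected, so it falls into one of the two parts. Density of the complement of `V` keeps the
  -- thickened parts disjoint in `U`.
  have key := isPreconnected_iff_subset_of_disjoint.1 hc (interior (A ∪ V)) (interior (B ∪ V))
    isOpen_interior isOpen_interior ?_ ?_
  · have aux : ∀ C : Set E, U ⊆ interior (C ∪ V) → U \ V ⊆ C := fun C hC x hx =>
      (interior_subset (hC hx.1)).resolve_right hx.2
    exact key.imp (aux A) (aux B)
  · intro x hx
    obtain ⟨r, hr, hball⟩ := Metric.isOpen_iff.1 hU x hx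
    have hb := isPreconnected_iff_subset_of_disjoint.1
      (isPreconnected_ball_diff_countable h hV x hr) A B hA hB
      ((sdiff_subset_sdiff_left hball).trans hAB)
      (subset_empty_iff.1 (hd ▸ inter_subset_inter_left _ (sdiff_subset_sdiff_left hball)))
    have aux : ∀ C : Set E, Metric.ball x r \ V ⊆ C → x ∈ interior (C ∪ V) := fun C hC =>
      mem_interior.2 ⟨Metric.ball x r, by
        rw [union_comm]
        exact sdiff_subset_iff.1 hC, Metric.isOpen_ball, Metric.mem_ball_self hr⟩
    exact hb.imp (aux A) (aux B)
  · by_contra hne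
    obtain ⟨x, ⟨hxU, hxA, hxB⟩, hxV⟩ := (hV.dense_compl ℝ).inter_open_nonempty _
      (hU.inter (isOpen_interior.inter isOpen_interior)) (nonempty_iff_ne_empty.2 hne)
    have : x ∈ U \ V ∩ (A ∩ B) := ⟨⟨hxU, hxV⟩, (interior_subset hxA).resolve_right hxV,
      (interior_subset hxB).resolve_right hxV⟩
    rw [hd] at this
    exact this

end Connected

theorem one_lt_rank_plane : 1 < Module.rank ℝ Plane := by
  rw [← Module.finrank_eq_rank, finrank_euclideanSpace]
  norm_num

/-! ### Local structure of a plane complex -/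

section Local

variable {Δ : SimplicialComplex ℝ Plane}

theorem affineIndependent_triple {a b c : Plane} [DecidableEq Plane] (h : {a, b, c} ∈ Δ.faces)
    (hab : a ≠ b) (hac : a ≠ c) (hbc : b ≠ c) : AffineIndependent ℝ ![a, b, c] := by
  have hi := Δ.indep h
  let f : Fin 3 → ({a, b, c} : Finset Plane) := ![⟨a, by simp⟩, ⟨b, by simp⟩, ⟨c, by simp⟩]
  have hf : Function.Injective f := by
    intro i j hij
    fin_cases i <;> fin_cases j <;> simp_all [f]
  have := hi.comp_embedding ⟨f, hf⟩
  have hfun : ![a, b, c] = Subtype.val ∘ f := by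
    funext i
    fin_cases i <;> rfl
  rw [hfun]
  exact this

theorem exists_third [DecidableEq Plane] {t : Finset Plane} (ht : t.card = 3) {a b : Plane}
    (hab : a ≠ b) (ha : a ∈ t) (hb : b ∈ t) : ∃ c, a ≠ c ∧ b ≠ c ∧ t = {a, b, c} := by
  obtain ⟨x, y, z, hxy, hxz, hyz, rfl⟩ := Finset.card_eq_three.1 ht
  simp only [Finset.mem_insert, Finset.mem_singleton] at ha hb
  rcases ha with rfl | rfl | rfl <;> rcases hb with rfl | rfl | rfl <;>
    first
    | exact absurd rfl hab
    | exact ⟨x, by tauto, by tauto, by grind⟩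
    | exact ⟨y, by tauto, by tauto, by grind⟩
    | exact ⟨z, by tauto, by tauto, by grind⟩

theorem coe_triple [DecidableEq Plane] (a b c : Plane) :
    (({a, b, c} : Finset Plane) : Set Plane) = {a, b, c} := by simp

/-- Two triangles with a common side lie on different sides of it. -/
theorem cross_mul_cross_neg [DecidableEq Plane] {a b c d : Plane} (hab : a ≠ b) (hac : a ≠ c)
    (hbc : b ≠ c) (had : a ≠ d) (hbd : b ≠ d) (hcd : c ≠ d) (hs : {a, b, c} ∈ Δ.faces)
    (ht : {a, b, d} ∈ Δ.faces) : cross a b c * cross a b d < 0 := by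
  have hc := cross_ne_zero (affineIndependent_triple hs hab hac hbc)
  have hd := cross_ne_zero (affineIndependent_triple ht hab had hbd)
  by_contra! hpos
  have hpos : 0 < cross a b c * cross a b d := lt_of_le_of_ne hpos (mul_ne_zero hc hd).symm
  have h2 : (0 : ℝ) < 1 / 2 := by norm_num
  have h12 : (1 / 2 : ℝ) + 1 / 2 = 1 := by norm_num
  -- If `c` and `d` were on the same side, a point slightly off the midpoint of `a b` towards `c`
  -- would lie in both triangles, hence in the hull of the common vertices, where `cross a b`
  -- vanishes.
  have hlim : Tendsto (fun r : ℝ => ((1 - r) / 2) • a + ((1 - r) / 2) • b + r • c) (𝓝[>] 0)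
      (𝓝 ((1 / 2 : ℝ) • a + (1 / 2 : ℝ) • b)) := by
    have : Continuous (fun r : ℝ => ((1 - r) / 2) • a + ((1 - r) / 2) • b + r • c) := by fun_prop
    have := (this.tendsto 0).mono_left (nhdsWithin_le_nhds (s := Ioi 0))
    simpa using this
  obtain ⟨r, h3, h4, hr⟩ := ((hlim.eventually (eventually_mem_triangle hc h2 h2 h12)).and
    ((hlim.eventually (eventually_mem_triangle hd h2 h2 h12)).and self_mem_nhdsWithin)).exists
  have hr : 0 < r := hr
  have hx : ∀ e, cross a b (((1 - r) / 2) • a + ((1 - r) / 2) • b + r • c) * e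
      = r * (cross a b c * e) := fun e => by
    rw [cross_comb (by ring), cross_left, cross_right]; ring
  rw [hx] at h3 h4
  have hmem := Δ.inter_subset_convexHull hs ht
    ⟨by rw [coe_triple]; exact h3 (mul_nonneg hr.le (mul_self_nonneg _)),
      by rw [coe_triple]; exact h4 (mul_pos hr hpos).le⟩
  rw [coe_triple, coe_triple] at hmem
  have hsub : ({a, b, c} ∩ {a, b, d} : Set Plane) ⊆ {a, b} := by
    rintro x ⟨h1, h2⟩
    simp only [mem_insert_iff, mem_singleton_iff] at h1 h2 ⊢
    rcases h1 with h1 | h1 | h1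
    · exact Or.inl h1
    · exact Or.inr h1
    · rcases h2 with h2 | h2 | h2
      · exact Or.inl h2
      · exact Or.inr h2
      · exact absurd (h1.symm.trans h2) hcd
  have hmem := convexHull_mono hsub hmem
  rw [convexHull_pair] at hmem
  obtain ⟨u, v, -, -, huv, hp⟩ := hmem
  have h0 : cross a b (((1 - r) / 2) • a + ((1 - r) / 2) • b + r • c) = 0 := by
    rw [← hp]
    have := cross_comb (a := a) (b := b) (c := c) (d := a) (e := b) (α := u) (β := v) (γ := 0)
      (by rw [add_zero, huv])
    simpa [cross_left, cross_right] using this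
  have := hx 1
  rw [h0] at this
  simp [hr.ne', hc] at this

theorem exists_pair_of_mem_edges [DecidableEq Plane] {e : Finset Plane} (he : e ∈ edges Δ) :
    ∃ a b, a ≠ b ∧ e = {a, b} := Finset.card_eq_two.1 he.2

/-- An edge lies on at most two triangles. -/
theorem eq_or_eq_or_eq_of_edge_subset {e t₁ t₂ t₃ : Finset Plane} (he : e ∈ edges Δ)
    (h₁ : t₁ ∈ triangles Δ) (h₂ : t₂ ∈ triangles Δ) (h₃ : t₃ ∈ triangles Δ) (he₁ : e ⊆ t₁)
    (he₂ : e ⊆ t₂) (he₃ : e ⊆ t₃) : t₁ = t₂ ∨ t₁ = t₃ ∨ t₂ = t₃ := by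
  classical
  obtain ⟨a, b, hab, rfl⟩ := exists_pair_of_mem_edges he
  simp only [Finset.insert_subset_iff, Finset.singleton_subset_iff] at he₁ he₂ he₃
  obtain ⟨c, hac, hbc, rfl⟩ := exists_third h₁.2 hab he₁.1 he₁.2
  obtain ⟨d, had, hbd, rfl⟩ := exists_third h₂.2 hab he₂.1 he₂.2
  obtain ⟨f, haf, hbf, rfl⟩ := exists_third h₃.2 hab he₃.1 he₃.2
  by_contra! hne
  have hcd : c ≠ d := fun h => hne.1 (by rw [h])
  have hcf : c ≠ f := fun h => hne.2.1 (by rw [h])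
  have hdf : d ≠ f := fun h => hne.2.2 (by rw [h])
  have e1 := cross_mul_cross_neg hab hac hbc had hbd hcd h₁.1 h₂.1
  have e2 := cross_mul_cross_neg hab hac hbc haf hbf hcf h₁.1 h₃.1
  have e3 := cross_mul_cross_neg hab had hbd haf hbf hdf h₂.1 h₃.1
  -- Three reals cannot have pairwise opposite signs.
  have := mul_pos_of_neg_of_neg e1 e2
  nlinarith [mul_self_nonneg (cross a b c), mul_nonneg (mul_self_nonneg (cross a b c))
    (neg_nonneg.2 e3.le)]

theorem mem_interior_space_of_triangle {t : Finset Plane} (ht : t ∈ triangles Δ) {w : Plane → ℝ}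
    {p : Plane} (hw : IsBary t w p) (hpos : ∀ x ∈ t, 0 < w x) :
    p ∈ interior (convexHull ℝ (t : Set Plane)) := by
  classical
  obtain ⟨a, b, c, hab, hac, hbc, rfl⟩ := Finset.card_eq_three.1 ht.2
  have hc := cross_ne_zero (affineIndependent_triple ht.1 hab hac hbc)
  have h1 := hw.sum_eq_one
  have h2 := hw.sum_smul
  rw [Finset.sum_insert (by simp [hab, hac]), Finset.sum_pair hbc, ← add_assoc] at h1 h2
  rw [coe_triple, ← h2]
  exact mem_interior_triangle hc (hpos a (by simp)) (hpos b (by simp)) (hpos c (by simp)) h1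

/-- The inner points of an edge which lies on two triangles are interior points. -/
theorem mem_interior_space_of_edge {e s t : Finset Plane} (he : e ∈ edges Δ)
    (hs : s ∈ triangles Δ) (ht : t ∈ triangles Δ) (hst : s ≠ t) (hes : e ⊆ s) (het : e ⊆ t)
    {w : Plane → ℝ} {p : Plane} (hw : IsBary e w p) (hpos : ∀ x ∈ e, 0 < w x) :
    p ∈ interior Δ.space := by
  classical
  obtain ⟨a, b, hab, rfl⟩ := exists_pair_of_mem_edges he
  simp only [Finset.insert_subset_iff, Finset.singleton_subset_iff] at hes het
  obtain ⟨c, hac, hbc, rfl⟩ := exists_third hs.2 hab hes.1 hes.2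
  obtain ⟨d, had, hbd, rfl⟩ := exists_third ht.2 hab het.1 het.2
  have hcd : c ≠ d := fun h => hst (by rw [h])
  have hneg := cross_mul_cross_neg hab hac hbc had hbd hcd hs.1 ht.1
  have hc := cross_ne_zero (affineIndependent_triple hs.1 hab hac hbc)
  have hd := cross_ne_zero (affineIndependent_triple ht.1 hab had hbd)
  have h1 := hw.sum_eq_one
  have h2 := hw.sum_smul
  rw [Finset.sum_pair hab] at h1 h2
  rw [mem_interior_iff_mem_nhds, ← h2]
  have ha := hpos a (by simp)
  have hb := hpos b (by simp)
  filter_upwards [eventually_mem_triangle hc ha hb h1, eventually_mem_triangle hd ha hb h1]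
    with x h3 h4
  rcases le_total 0 (cross a b x * cross a b c) with h | h
  · exact SimplicialComplex.convexHull_subset_space hs.1 (by rw [coe_triple]; exact h3 h)
  · refine SimplicialComplex.convexHull_subset_space ht.1 (by
      rw [coe_triple]
      refine h4 ?_
      by_contra! h5
      have := mul_nonneg_of_nonpos_of_nonpos h h5.le
      have h6 := mul_self_nonneg (cross a b x)
      have h7 : cross a b x ≠ 0 := fun h0 => by simp [h0] at h5
      have h8 := mul_self_pos.2 h7
      nlinarith [mul_pos h8 (neg_pos.2 hneg)])

theorem card_le_three {s : Finset Plane} (hs : s ∈ Δ.faces) : s.card ≤ 3 := by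
  have := (Δ.indep hs).card_le_finrank_succ
  have h2 := Submodule.finrank_le (vectorSpan ℝ (Set.range ((↑) : s → Plane)))
  rw [finrank_euclideanSpace] at h2
  simp at this h2
  omega

/-- At most two points span an affine space of dimension at most one, whereas nonempty interior
forces the span to be the plane. -/
theorem interior_convexHull_eq_empty {s : Finset Plane} (hs : s ∈ Δ.faces) (h3 : s.card ≠ 3) :
    interior (convexHull ℝ (s : Set Plane)) = ∅ := by
  by_contra hne
  have h := interior_convexHull_nonempty_iff_affineSpan_eq_top.1 (nonempty_iff_ne_empty.2 hne)
  have hc : s.card ≤ 2 := by have := card_le_three hs; omega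
  have hpos := (SimplicialComplex.nonempty_of_mem_faces hs).card_pos
  have h1 := finrank_vectorSpan_range_le ℝ ((↑) : s → Plane) (n := s.card - 1)
    (by simp; omega)
  rw [← direction_affineSpan, Subtype.range_coe_subtype] at h1
  have h' : {x | x ∈ s} = (s : Set Plane) := rfl
  rw [h', h, AffineSubspace.direction_top, finrank_top, finrank_euclideanSpace] at h1
  simp at h1
  omega

end Local

/-! ### Purity, interior points and connectedness of the dual graph -/

theorem isClosed_convexHull_finset (s : Finset Plane) :
    IsClosed (convexHull ℝ (s : Set Plane)) :=
  s.finite_toSet.isClosed_convexHull ℝ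

theorem finite_triangles {Δ : SimplicialComplex ℝ Plane} (h : Δ.faces.Finite) :
    (triangles Δ).Finite := h.subset fun _ ht => ht.1

theorem finite_vertices {Δ : SimplicialComplex ℝ Plane} (h : Δ.faces.Finite) :
    Δ.vertices.Finite := h.preimage Finset.singleton_injective.injOn

section Complex

variable {Δ : SimplicialComplex ℝ Plane} {Ω : Set Plane}

theorem mem_edges_of_subset {t : Finset Plane} (ht : t ∈ triangles Δ) {e : Finset Plane}
    (het : e ⊆ t) (he : e.card = 2) : e ∈ edges Δ :=
  ⟨Δ.down_closed ht.1 het (Finset.card_pos.1 (by omega)), he⟩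

theorem mem_vertices_of_mem {s : Finset Plane} (hs : s ∈ Δ.faces) {x : Plane} (hx : x ∈ s) :
    x ∈ Δ.vertices :=
  Δ.down_closed hs (Finset.singleton_subset_iff.2 hx) (Finset.singleton_nonempty x)

theorem isBary_vertex [DecidableEq Plane] (v : Plane) :
    IsBary {v} (fun x => if x = v then 1 else 0) v := isBary_single (by simp)

/-- A triangulation of a region is pure. -/
theorem exists_triangle_of_mem_space (hΔ : IsTriangulationOf Δ Ω) {p : Plane}
    (hp : p ∈ Δ.space) : ∃ t ∈ triangles Δ, p ∈ convexHull ℝ (t : Set Plane) := by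
  set K : Set Plane := ⋃ t ∈ triangles Δ, convexHull ℝ (t : Set Plane) with hK
  have hKc : IsClosed K := (finite_triangles hΔ.finite_faces).isClosed_biUnion
    fun t _ => isClosed_convexHull_finset t
  have hsub : Ω ⊆ K := by
    by_contra hne
    obtain ⟨x, hxΩ, hxK⟩ := not_subset.1 hne
    -- The points outside all simplices of dimension below two are dense, so one of them lies in the
    -- open set `Ω \ K`; yet it must lie in a triangle.
    have hd := dense_biInter_of_isOpen (S := {s | s ∈ Δ.faces ∧ s.card ≠ 3})
      (f := fun s : Finset Plane => (convexHull ℝ (s : Set Plane))ᶜ)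
      (fun s _ => (isClosed_convexHull_finset s).isOpen_compl)
      (hΔ.finite_faces.subset fun _ h => h.1).countable
      (fun s hs => interior_eq_empty_iff_dense_compl.1 (interior_convexHull_eq_empty hs.1 hs.2))
    obtain ⟨y, ⟨hyΩ, hyK⟩, hy⟩ := hd.inter_open_nonempty _
      (hΔ.isOpen.inter hKc.isOpen_compl) ⟨x, hxΩ, hxK⟩
    have hys : y ∈ Δ.space := hΔ.space_eq ▸ subset_closure hyΩ
    obtain ⟨s, hs, hys⟩ := SimplicialComplex.mem_space_iff.1 hys
    by_cases h3 : s.card = 3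
    · exact hyK (mem_biUnion (show s ∈ triangles Δ from ⟨hs, h3⟩) hys)
    · exact mem_iInter₂.1 hy s ⟨hs, h3⟩ hys
  rw [hΔ.space_eq] at hp
  have := closure_minimal hsub hKc hp
  simpa [hK] using this

theorem exists_triangle_of_mem_vertices (hΔ : IsTriangulationOf Δ Ω) {v : Plane}
    (hv : v ∈ Δ.vertices) : ∃ t ∈ triangles Δ, v ∈ t := by
  obtain ⟨t, ht, hvt⟩ := exists_triangle_of_mem_space hΔ
    (SimplicialComplex.vertices_subset_space hv)
  exact ⟨t, ht, (SimplicialComplex.vertex_mem_convexHull_iff hv ht.1).1 hvt⟩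

/-- A point of a triangle which is not a vertex is either inside the triangle or inside one of its
sides. -/
theorem exists_carrier {t : Finset Plane} (ht : t ∈ triangles Δ) {p : Plane}
    (hp : p ∈ convexHull ℝ (t : Set Plane)) (hv : p ∉ Δ.vertices) :
    ∃ s ⊆ t, ∃ w, IsBary s w p ∧ (∀ x ∈ s, 0 < w x) ∧ (s = t ∨ s ∈ edges Δ) := by
  classical
  obtain ⟨w, hw⟩ := exists_isBary hp
  have hsub : t.filter (fun x => 0 < w x) ⊆ t := Finset.filter_subset _ _
  have hb : IsBary (t.filter fun x => 0 < w x) w p := hw.restrict hsub fun x hx hx' => by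
    simp only [Finset.mem_filter, hx, true_and, not_lt] at hx'
    exact le_antisymm hx' (hw.nonneg x)
  refine ⟨_, hsub, w, hb, fun x hx => (Finset.mem_filter.1 hx).2, ?_⟩
  generalize t.filter (fun x => 0 < w x) = s at hsub hb
  have h3 := ht.2
  have hle := Finset.card_le_card hsub
  have h0 : s.card ≠ 0 := fun h => by
    rw [Finset.card_eq_zero] at h
    simpa [h] using hb.sum_eq_one
  have h1 : s.card ≠ 1 := fun h => by
    obtain ⟨v, rfl⟩ := Finset.card_eq_one.1 h
    have e1 := hb.sum_eq_one
    have e2 := hb.sum_smul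
    simp only [Finset.sum_singleton] at e1 e2
    rw [e1, one_smul] at e2
    exact hv (e2 ▸ mem_vertices_of_mem ht.1 (Finset.singleton_subset_iff.1 hsub))
  by_cases h2 : s.card = 2
  · exact Or.inr (mem_edges_of_subset ht hsub h2)
  · exact Or.inl (Finset.eq_of_subset_of_card_le hsub (by omega))

theorem exists_ne_of_notMem_boundaryEdges {e t : Finset Plane} (he : e ∈ edges Δ)
    (hb : e ∉ boundaryEdges Δ) (ht : t ∈ triangles Δ) (het : e ⊆ t) :
    ∃ s ∈ triangles Δ, t ≠ s ∧ e ⊆ s := by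
  by_contra! h
  refine hb ⟨he, t, ⟨ht, het⟩, fun s hs => ?_⟩
  by_contra hne
  exact h s hs.1 (Ne.symm hne) hs.2

/-- The points of the complex outside the vertices and the boundary edges are interior points. -/
theorem mem_interior_space (hΔ : IsTriangulationOf Δ Ω) {p : Plane} (hp : p ∈ Δ.space)
    (hv : p ∉ Δ.vertices) (hb : ∀ e ∈ boundaryEdges Δ, p ∉ convexHull ℝ (e : Set Plane)) :
    p ∈ interior Δ.space := by
  obtain ⟨t, ht, hpt⟩ := exists_triangle_of_mem_space hΔ hp
  obtain ⟨s, hst, w, hw, hpos, rfl | he⟩ := exists_carrier ht hpt hv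
  · exact interior_mono (SimplicialComplex.convexHull_subset_space ht.1)
      (mem_interior_space_of_triangle ht hw hpos)
  · obtain ⟨t', ht', hne, het'⟩ := exists_ne_of_notMem_boundaryEdges he
      (fun h => hb s h hw.mem_convexHull) ht hst
    exact mem_interior_space_of_edge he ht ht' hne hst het' hw hpos

/-- The dual graph is connected: a nonempty set of triangles which is closed under passing to a
triangle with a common edge contains all the triangles. -/
theorem dual_connected (hΔ : IsTriangulationOf Δ Ω) {S : Set (Finset Plane)}
    (hS : S ⊆ triangles Δ) (hne : S.Nonempty)
    (hcl : ∀ s ∈ S, ∀ t ∈ triangles Δ, ∀ e ∈ edges Δ, e ⊆ s → e ⊆ t → t ∈ S) :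
    triangles Δ ⊆ S := by
  classical
  have hfin := finite_triangles hΔ.finite_faces
  have hVc := (finite_vertices hΔ.finite_faces).countable
  -- Triangles of different classes can meet only in vertices. Once these are removed, the region
  -- stays connected and is covered by two disjoint closed parts.
  have hcon := isPreconnected_diff_countable one_lt_rank_plane hΔ.isOpen
    hΔ.isConnected.isPreconnected hVc
  have hclosed : ∀ R ⊆ triangles Δ, IsClosed (⋃ t ∈ R, convexHull ℝ (t : Set Plane)) :=
    fun R hR => (hfin.subset hR).isClosed_biUnion fun t _ => isClosed_convexHull_finset t
  -- a point common to two triangles in different classes is a vertex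
  have hinter : ∀ s ∈ S, ∀ t ∈ triangles Δ \ S, ∀ p ∈ convexHull ℝ (s : Set Plane),
      p ∈ convexHull ℝ (t : Set Plane) → p ∈ Δ.vertices := by
    intro s hs t ht p hps hpt
    by_contra hv
    obtain ⟨s', hs's, w, hw, hpos, h⟩ := exists_carrier (hS hs) hps hv
    obtain ⟨w', hw'⟩ := exists_isBary hpt
    have hww := IsBary.unique (hS hs).1 ht.1.1 (hw.mono hs's) hw'
    have hsub : s' ⊆ t := fun x hx => by
      by_contra hxt
      have := hpos x hx
      rw [hww, hw'.eq_zero x hxt] at this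
      exact this.false
    rcases h with rfl | he
    · have := Finset.eq_of_subset_of_card_le hsub (by rw [(hS hs).2, ht.1.2])
      exact ht.2 (this ▸ hs)
    · exact ht.2 (hcl s hs t ht.1 s' he hs's hsub)
  -- every triangle meets the region outside the vertices
  have hmeet : ∀ t ∈ triangles Δ,
      (Ω \ Δ.vertices ∩ convexHull ℝ (t : Set Plane)).Nonempty := by
    intro t ht
    have hi := mem_interior_space_of_triangle ht (isBary_barycenter
      (SimplicialComplex.nonempty_of_mem_faces ht.1)) (fun x hx => by simp [hx, ht.2])
    have hcl : barycenter t ∈ closure Ω := hΔ.space_eq ▸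
      SimplicialComplex.convexHull_subset_space ht.1 (interior_subset hi)
    have hn : (interior (convexHull ℝ (t : Set Plane)) ∩ Ω).Nonempty :=
      mem_closure_iff.1 hcl _ isOpen_interior hi
    obtain ⟨x, ⟨hx1, hx2⟩, hx3⟩ := (hVc.dense_compl ℝ).inter_open_nonempty _
      (isOpen_interior.inter hΔ.isOpen) hn
    exact ⟨x, ⟨hx2, hx3⟩, interior_subset hx1⟩
  by_contra hnot
  obtain ⟨t, ht, htS⟩ := not_subset.1 hnot
  obtain ⟨s, hs⟩ := hne
  have := isPreconnected_iff_subset_of_disjoint_closed.1 hcon _ _ (hclosed S hS)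
    (hclosed (triangles Δ \ S) sdiff_subset) ?_ ?_
  · rcases this with h | h
    · obtain ⟨x, hx, hxt⟩ := hmeet t ht
      obtain ⟨s', hs', hxs'⟩ := mem_iUnion₂.1 (h hx)
      exact hx.2 (hinter s' hs' t ⟨ht, htS⟩ x hxs' hxt)
    · obtain ⟨x, hx, hxs⟩ := hmeet s (hS hs)
      obtain ⟨t', ht', hxt'⟩ := mem_iUnion₂.1 (h hx)
      exact hx.2 (hinter s hs t' ht' x hxs hxt')
  · intro x hx
    obtain ⟨t', ht', hxt'⟩ := exists_triangle_of_mem_space hΔ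
      (hΔ.space_eq ▸ subset_closure hx.1)
    by_cases h : t' ∈ S
    · exact Or.inl (mem_biUnion h hxt')
    · exact Or.inr (mem_biUnion (show t' ∈ triangles Δ \ S from ⟨ht', h⟩) hxt')
  · rw [eq_empty_iff_forall_notMem]
    rintro x ⟨hx, hx1, hx2⟩
    obtain ⟨s', hs', hxs'⟩ := mem_iUnion₂.1 hx1
    obtain ⟨t', ht', hxt'⟩ := mem_iUnion₂.1 hx2
    exact hx.2 (hinter s' hs' t' ht' x hxs' hxt')

theorem isClosed_space (hΔ : IsTriangulationOf Δ Ω) : IsClosed Δ.space :=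
  hΔ.finite_faces.isClosed_biUnion fun s _ => isClosed_convexHull_finset s

theorem isBounded_space (hΔ : IsTriangulationOf Δ Ω) : Bornology.IsBounded Δ.space :=
  (Bornology.isBounded_biUnion hΔ.finite_faces).2 fun s _ =>
    (s.finite_toSet.isCompact_convexHull ℝ).isBounded

theorem nonempty_triangles (hΔ : IsTriangulationOf Δ Ω) : (triangles Δ).Nonempty := by
  obtain ⟨x, hx⟩ := hΔ.isConnected.nonempty
  obtain ⟨t, ht, -⟩ := exists_triangle_of_mem_space hΔ (hΔ.space_eq ▸ subset_closure hx)
  exact ⟨t, ht⟩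

/-- A connected open set which avoids the boundary edges and meets the interior of the complex is
contained in the complex. -/
theorem subset_space_of_disjoint_boundaryEdges (hΔ : IsTriangulationOf Δ Ω) {U : Set Plane}
    (hU : IsOpen U) (hc : IsPreconnected U)
    (hb : ∀ e ∈ boundaryEdges Δ, Disjoint U (convexHull ℝ (e : Set Plane)))
    (hne : (U ∩ Δ.space).Nonempty) : U ⊆ Δ.space := by
  have hVc := (finite_vertices hΔ.finite_faces).countable
  have hcon := isPreconnected_diff_countable one_lt_rank_plane hU hc hVc
  have hcl := isClosed_space hΔ
  have hint : ∀ x ∈ U \ Δ.vertices, x ∈ Δ.space → x ∈ interior Δ.space := fun x hx hxs =>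
    mem_interior_space hΔ hxs hx.2 fun e he hxe => (disjoint_left.1 (hb e he)) hx.1 hxe
  -- Away from the vertices no point of `U` is a frontier point of the complex, so `U` minus the
  -- vertices is entirely inside or entirely outside.
  have hor := isPreconnected_iff_subset_of_disjoint.1 hcon (interior Δ.space) Δ.spaceᶜ
    isOpen_interior hcl.isOpen_compl
    (fun x hx => (em (x ∈ Δ.space)).imp (hint x hx) id)
    (eq_empty_of_forall_notMem fun x hx => hx.2.2 (interior_subset hx.2.1))
  obtain ⟨p, hpU, hp⟩ := hne
  rw [hΔ.space_eq] at hp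
  obtain ⟨x, ⟨hxU, hxΩ⟩, hxV⟩ := (hVc.dense_compl ℝ).inter_open_nonempty _ (hU.inter hΔ.isOpen)
    (mem_closure_iff.1 hp U hU hpU)
  rcases hor with h | h
  · intro y hy
    have : U ⊆ closure (U ∩ Δ.verticesᶜ) := (hVc.dense_compl ℝ).open_subset_closure_inter hU
    exact closure_minimal (h.trans interior_subset) hcl (this hy)
  · exact absurd (hΔ.space_eq ▸ subset_closure hxΩ) (h ⟨hxU, hxV⟩)

/-! ### The drawing of the dual graph -/

/-- A point of the drawing of the dual graph lies on the half-edge from the barycentre of a triangle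
towards an edge on another triangle, or is a barycentre. -/
theorem mem_dualDrawing_cases {p : Plane} (hp : p ∈ dualDrawing Δ) :
    (∃ t ∈ triangles Δ, p = barycenter t) ∨
    ∃ s ∈ triangles Δ, ∃ t ∈ triangles Δ, ∃ e ∈ edges Δ, s ≠ t ∧ e ⊆ s ∧ e ⊆ t ∧
      p ∈ segment ℝ (barycenter s) (barycenter e) := by
  rcases hp with h | ⟨s, hs, t, ht, e, he, hst, hes, het, h | h⟩
  · exact Or.inl h
  · exact Or.inr ⟨s, hs, t, ht, e, he, hst, hes, het, h⟩
  · exact Or.inr ⟨t, ht, s, hs, e, he, hst.symm, het, hes, by rwa [segment_symm]⟩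

/-- At the points of the drawing, the largest barycentric coordinate is attained twice. If the
point lies on an edge, then it lies on two triangles. -/
theorem exists_isBary_of_mem_dualDrawing {p : Plane} (hp : p ∈ dualDrawing Δ) :
    ∃ s ∈ triangles Δ, ∃ w, IsBary s w p ∧
      (∃ x ∈ s, ∃ y ∈ s, x ≠ y ∧ w x = w y ∧ ∀ z, w z ≤ w x) ∧
      ((∀ x ∈ s, 0 < w x) ∨ ∃ t ∈ triangles Δ, s ≠ t ∧ ∀ x, 0 < w x → x ∈ t) := by
  classical
  rcases mem_dualDrawing_cases hp with ⟨t, ht, rfl⟩ | ⟨s, hs, t, ht, e, he, hst, hes, het, hpe⟩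
  · obtain ⟨x, hx, y, hy, hxy⟩ := Finset.one_lt_card.1 (show 1 < t.card by rw [ht.2]; norm_num)
    refine ⟨t, ht, _, isBary_barycenter (SimplicialComplex.nonempty_of_mem_faces ht.1),
      ⟨x, hx, y, hy, hxy, by simp [hx, hy], fun v => ?_⟩,
      Or.inl fun v hv => by simp only [hv, if_true, ht.2]; norm_num⟩
    by_cases hv : v ∈ t <;> simp [hv, hx]
  · obtain ⟨a, b, hab, rfl⟩ := exists_pair_of_mem_edges he
    obtain ⟨u, v, hu, hv, huv, rfl⟩ := hpe
    -- On the half-edge both ends of the shared edge have weight `u/3 + v/2` and the third vertex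
    -- has `u/3`. The case `u = 0` is the midpoint, which belongs to `t` as well.
    have hw := (isBary_barycenter (SimplicialComplex.nonempty_of_mem_faces hs.1)).combine
      ((isBary_barycenter (SimplicialComplex.nonempty_of_mem_faces he.1)).mono hes) hu hv huv
    rw [hs.2, he.2] at hw
    have ha : a ∈ s := hes (by simp)
    have hb : b ∈ s := hes (by simp)
    refine ⟨s, hs, _, hw, ⟨a, ha, b, hb, hab, by simp [ha, hb], ?_⟩, ?_⟩
    · intro z
      have ha' : a ∈ ({a, b} : Finset Plane) := by simp
      simp only [ha, ha', if_true]
      gcongr <;> split_ifs <;> simp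
    · rcases hu.eq_or_lt with rfl | hu
      · refine Or.inr ⟨t, ht, hst, fun x hx => ?_⟩
        by_contra hxt
        have : x ∉ ({a, b} : Finset Plane) := fun h => hxt (het h)
        simp [-Finset.mem_insert, -Finset.mem_singleton, this] at hx
      · refine Or.inl fun x hx => ?_
        have : 0 ≤ v * (if x ∈ ({a, b} : Finset Plane) then ((2 : ℕ) : ℝ)⁻¹ else 0) := by
          split_ifs <;> positivity
        simp only [hx, if_true]
        have : 0 < u * ((3 : ℕ) : ℝ)⁻¹ := by positivity
        linarith

end Complex

/-! ### The faces of the drawing -/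

section Faces

variable {Δ : SimplicialComplex ℝ Plane} {Ω : Set Plane}

/-- A strictly dominant coordinate contradicts the tie for the maximum on the drawing. This is the
tool for moving within the complement. -/
theorem notMem_dualDrawing_of_lt {t : Finset Plane} (ht : t ∈ Δ.faces) {w : Plane → ℝ} {p : Plane}
    (hw : IsBary t w p) {v : Plane} (hv : ∀ x, x ≠ v → w x < w v) : p ∉ dualDrawing Δ := by
  intro hp
  obtain ⟨s, hs, w', hw', ⟨x, -, y, -, hxy, hxy', hmax⟩, -⟩ := exists_isBary_of_mem_dualDrawing hp
  obtain rfl := IsBary.unique ht hs.1 hw hw'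
  by_cases hx : x = v
  · subst hx
    exact (hv y hxy.symm).ne' hxy'
  · exact (hv x hx).not_ge (hmax v)

theorem notMem_dualDrawing_of_mem_vertices {v : Plane} (hv : v ∈ Δ.vertices) :
    v ∉ dualDrawing Δ := by
  classical
  exact notMem_dualDrawing_of_lt hv (isBary_vertex v) (v := v) fun x hx => by simp [hx]

/-- At a drawing point the two tied maximal weights are positive, so they sit at the two ends of
`e`. Then either a third weight is positive, impossible on an edge, or `e` lies on a second
triangle. -/
theorem notMem_dualDrawing_of_boundaryEdge {e : Finset Plane} (he : e ∈ boundaryEdges Δ)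
    {p : Plane} (hp : p ∈ convexHull ℝ (e : Set Plane)) : p ∉ dualDrawing Δ := by
  classical
  intro hD
  obtain ⟨w, hw⟩ := exists_isBary hp
  obtain ⟨s, hs, w', hw', ⟨x, hx, y, hy, hxy, hxy', hmax⟩, h⟩ := exists_isBary_of_mem_dualDrawing hD
  obtain rfl := IsBary.unique he.1.1 hs.1 hw hw'
  have hpos : 0 < w x := by
    by_contra! hle
    have : ∑ z ∈ s, w z ≤ 0 := Finset.sum_nonpos fun z _ => (hmax z).trans hle
    rw [hw'.sum_eq_one] at this
    linarith
  have hmem : ∀ z, 0 < w z → z ∈ e := fun z hz => by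
    by_contra hze
    exact hz.ne' (hw.eq_zero z hze)
  have hexy : {x, y} = e := Finset.eq_of_subset_of_card_le (by
      simp only [Finset.insert_subset_iff, Finset.singleton_subset_iff]
      exact ⟨hmem x hpos, hmem y (hxy' ▸ hpos)⟩) (by rw [he.1.2, Finset.card_pair hxy])
  have hes : e ⊆ s := by
    rw [← hexy]
    simp only [Finset.insert_subset_iff, Finset.singleton_subset_iff]
    exact ⟨hx, hy⟩
  rcases h with h | ⟨t, ht, hst, h⟩
  · have := Finset.card_le_card fun z hz => hmem z (h z hz)
    rw [hs.2, he.1.2] at this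
    omega
  · have het : e ⊆ t := by
      rw [← hexy]
      simp only [Finset.insert_subset_iff, Finset.singleton_subset_iff]
      exact ⟨h x hpos, h y (hxy' ▸ hpos)⟩
    exact hst (he.2.unique ⟨hs, hes⟩ ⟨ht, het⟩)

theorem dualDrawing_subset_space : dualDrawing Δ ⊆ Δ.space := fun p hp => by
  obtain ⟨s, hs, w, hw, -⟩ := exists_isBary_of_mem_dualDrawing hp
  exact SimplicialComplex.convexHull_subset_space hs.1 hw.mem_convexHull

theorem dualDrawing_subset_interior (hΔ : IsTriangulationOf Δ Ω) :
    dualDrawing Δ ⊆ interior Δ.space := fun _ hp =>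
  mem_interior_space hΔ (dualDrawing_subset_space hp)
    (fun hv => notMem_dualDrawing_of_mem_vertices hv hp)
    fun _ he hpe => notMem_dualDrawing_of_boundaryEdge he hpe hp

theorem isClosed_dualDrawing (hΔ : IsTriangulationOf Δ Ω) : IsClosed (dualDrawing Δ) := by
  have hfin := finite_triangles hΔ.finite_faces
  have hE : (edges Δ).Finite := hΔ.finite_faces.subset fun _ h => h.1
  have hseg : ∀ a b : Plane, IsClosed (segment ℝ a b) := fun a b => by
    rw [← convexHull_pair]
    exact (toFinite {a, b}).isClosed_convexHull ℝ
  refine IsClosed.union ?_ ?_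
  · refine ((hfin.image barycenter).subset ?_).isClosed
    rintro p ⟨t, ht, rfl⟩
    exact mem_image_of_mem _ ht
  · have : {p | ∃ s ∈ triangles Δ, ∃ t ∈ triangles Δ, ∃ e ∈ edges Δ, s ≠ t ∧ e ⊆ s ∧ e ⊆ t ∧
        p ∈ segment ℝ (barycenter s) (barycenter e) ∪
          segment ℝ (barycenter e) (barycenter t)} =
        ⋃ q ∈ {q : Finset Plane × Finset Plane × Finset Plane | q ∈ triangles Δ ×ˢ
          triangles Δ ×ˢ edges Δ ∧ q.1 ≠ q.2.1 ∧ q.2.2 ⊆ q.1 ∧ q.2.2 ⊆ q.2.1},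
        (segment ℝ (barycenter q.1) (barycenter q.2.2) ∪
          segment ℝ (barycenter q.2.2) (barycenter q.2.1)) := by
      ext p
      simp only [mem_ofPred_eq, mem_iUnion, mem_prod, exists_prop, Prod.exists]
      constructor
      · rintro ⟨s, hs, t, ht, e, he, h1, h2, h3, h4⟩
        exact ⟨s, t, e, ⟨⟨hs, ht, he⟩, h1, h2, h3⟩, h4⟩
      · rintro ⟨s, t, e, ⟨⟨hs, ht, he⟩, h1, h2, h3⟩, h4⟩
        exact ⟨s, hs, t, ht, e, he, h1, h2, h3, h4⟩
    rw [this]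
    exact ((hfin.prod (hfin.prod hE)).subset fun q hq => hq.1).isClosed_biUnion
      fun q _ => (hseg _ _).union (hseg _ _)

/-- The component of a point in the complement of the drawing of the dual graph. -/
abbrev faceAt (Δ : SimplicialComplex ℝ Plane) (p : Plane) : Set Plane :=
  connectedComponentIn (dualDrawing Δ)ᶜ p

theorem faceAt_eq_of_segment {p q : Plane} (h : segment ℝ p q ⊆ (dualDrawing Δ)ᶜ) :
    faceAt Δ p = faceAt Δ q :=
  connectedComponentIn_eq ((convex_segment p q).isPreconnected.subset_connectedComponentIn
    (left_mem_segment ℝ p q) h (right_mem_segment ℝ p q))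

theorem faceAt_eq_of_boundaryEdge [DecidableEq Plane] {a b : Plane}
    (h : {a, b} ∈ boundaryEdges Δ) : faceAt Δ a = faceAt Δ b :=
  faceAt_eq_of_segment fun p hp => notMem_dualDrawing_of_boundaryEdge h (by
    rwa [Finset.coe_pair, convexHull_pair])

/-- A point of the complex outside the drawing lies in the face of a vertex. -/
theorem exists_vertex_faceAt_eq (hΔ : IsTriangulationOf Δ Ω) {p : Plane} (hp : p ∈ Δ.space)
    (hpD : p ∉ dualDrawing Δ) : ∃ v ∈ Δ.vertices, faceAt Δ p = faceAt Δ v := by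
  classical
  obtain ⟨t, ht, hpt⟩ := exists_triangle_of_mem_space hΔ hp
  obtain ⟨w, hw⟩ := exists_isBary hpt
  -- Moving towards a vertex of largest weight makes that weight strictly dominant at once, so the
  -- segment avoids the drawing.
  obtain ⟨v, hv, hmax⟩ := t.exists_max_image w (SimplicialComplex.nonempty_of_mem_faces ht.1)
  refine ⟨v, mem_vertices_of_mem ht.1 hv, faceAt_eq_of_segment ?_⟩
  rintro _ ⟨α, β, hα, hβ, hαβ, rfl⟩
  rcases hβ.eq_or_lt with rfl | hβ
  · obtain rfl : α = 1 := by linarith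
    simpa using hpD
  · refine notMem_dualDrawing_of_lt ht.1 (hw.combine (isBary_single hv) hα hβ.le hαβ)
      (v := v) fun x hx => ?_
    have hle : w x ≤ w v := by
      by_cases hxt : x ∈ t
      · exact hmax x hxt
      · rw [hw.eq_zero x hxt]
        exact hw.nonneg v
    have := mul_le_mul_of_nonneg_left hle hα
    simp only [hx, if_true, if_false]
    linarith

/-- Every face of the dual graph contains a vertex of the complex. -/
theorem exists_vertex_of_face (hΔ : IsTriangulationOf Δ Ω) {p : Plane} (hp : p ∉ dualDrawing Δ) :
    ∃ v ∈ Δ.vertices, faceAt Δ p = faceAt Δ v := by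
  by_cases h : (faceAt Δ p ∩ Δ.space).Nonempty
  · obtain ⟨q, hq, hqs⟩ := h
    rw [faceAt, connectedComponentIn_eq hq]
    exact exists_vertex_faceAt_eq hΔ hqs (connectedComponentIn_subset _ _ hq)
  -- A face missing the complex is clopen: a limit point on the drawing would be interior to the
  -- complex, and any other limit point belongs to the component. It would thus be the whole plane.
  · exfalso
    have hdis : ∀ x ∈ faceAt Δ p, x ∉ Δ.space := fun x hx hxs => h ⟨x, hx, hxs⟩
    have hpF : p ∈ faceAt Δ p := mem_connectedComponentIn hp
    have hopen : IsOpen (faceAt Δ p) :=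
      (isClosed_dualDrawing hΔ).isOpen_compl.connectedComponentIn
    have hclosed : IsClosed (faceAt Δ p) := by
      refine isClosed_of_closure_subset fun z hz => ?_
      have hzD : z ∉ dualDrawing Δ := fun hzD => by
        obtain ⟨y, hy, hyF⟩ := mem_closure_iff.1 hz _ isOpen_interior
          (dualDrawing_subset_interior hΔ hzD)
        exact hdis y hyF (interior_subset hy)
      have hpre : IsPreconnected (insert z (faceAt Δ p)) :=
        isPreconnected_connectedComponentIn.subset_closure (subset_insert _ _)
          (insert_subset hz subset_closure)
      exact hpre.subset_connectedComponentIn (mem_insert_of_mem _ hpF)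
        (insert_subset hzD (connectedComponentIn_subset _ _)) (mem_insert _ _)
    have huniv : faceAt Δ p = univ := IsClopen.eq_univ ⟨hclosed, hopen⟩ ⟨p, hpF⟩
    obtain ⟨t, ht⟩ := nonempty_triangles hΔ
    obtain ⟨x, hx⟩ := SimplicialComplex.nonempty_of_mem_faces ht.1
    exact hdis x (huniv ▸ mem_univ x) (SimplicialComplex.subset_space ht.1 hx)

theorem finite_dualBoundedFaces (hΔ : IsTriangulationOf Δ Ω) : (dualBoundedFaces Δ).Finite := by
  refine ((finite_vertices hΔ.finite_faces).image (faceAt Δ)).subset ?_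
  rintro _ ⟨-, p, hp, rfl⟩
  obtain ⟨v, hv, h⟩ := exists_vertex_of_face hΔ hp
  exact ⟨v, hv, h.symm⟩

/-- Some vertex of the complex lies in an unbounded face. -/
theorem exists_vertex_unbounded (hΔ : IsTriangulationOf Δ Ω) :
    ∃ v ∈ Δ.vertices, faceAt Δ v ∉ dualBoundedFaces Δ := by
  have hne : Δ.vertices.Nonempty := by
    obtain ⟨t, ht⟩ := nonempty_triangles hΔ
    obtain ⟨x, hx⟩ := SimplicialComplex.nonempty_of_mem_faces ht.1
    exact ⟨x, mem_vertices_of_mem ht.1 hx⟩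
  -- From a rightmost vertex the horizontal ray to the right leaves the complex, hence never meets
  -- the drawing.
  obtain ⟨v, hv, hmax⟩ := exists_max_image Δ.vertices (fun x : Plane => x 0)
    (finite_vertices hΔ.finite_faces) hne
  have hle : ∀ p ∈ Δ.space, p 0 ≤ v 0 := by
    intro p hp
    obtain ⟨s, hs, hps⟩ := SimplicialComplex.mem_space_iff.1 hp
    have hconv : Convex ℝ {x : Plane | x 0 ≤ v 0} := by
      intro x hx y hy a b ha hb hab
      simp only [mem_ofPred_eq, PiLp.add_apply, PiLp.smul_apply, smul_eq_mul] at hx hy ⊢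
      calc a * x 0 + b * y 0 ≤ a * v 0 + b * v 0 := by gcongr
        _ = v 0 := by rw [← add_mul, hab, one_mul]
    exact convexHull_min (fun x hx => hmax x (mem_vertices_of_mem hs hx)) hconv hps
  refine ⟨v, hv, fun hF => ?_⟩
  let ray : ℝ → Plane := fun r => v + r • EuclideanSpace.single 0 1
  have hray0 : ∀ r, ray r 0 = v 0 + r := fun r => by simp [ray]
  have hsub : ray '' Ici 0 ⊆ faceAt Δ v := by
    refine IsPreconnected.subset_connectedComponentIn (isPreconnected_Ici.image _
      (by fun_prop)) ⟨0, by simp, by simp [ray]⟩ ?_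
    rintro _ ⟨r, hr, rfl⟩ hD
    rcases (show (0 : ℝ) ≤ r from hr).eq_or_lt with rfl | hr
    · exact notMem_dualDrawing_of_mem_vertices hv (by simpa [ray] using hD)
    · have := hle _ (dualDrawing_subset_space hD)
      rw [hray0] at this
      linarith
  obtain ⟨C, hC⟩ := hF.1.exists_norm_le
  have h1 := hC _ (hsub ⟨|C| + |v 0| + 1, by simp only [mem_Ici]; positivity, rfl⟩)
  have h3 := PiLp.norm_apply_le (ray (|C| + |v 0| + 1)) 0
  rw [hray0, Real.norm_eq_abs] at h3
  have h4 := le_abs_self (v 0 + (|C| + |v 0| + 1))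
  have h5 := neg_abs_le (v 0)
  have h6 := le_abs_self C
  linarith

end Faces

/-! ### Counting -/

section Combinatorics

variable {α : Type*} [DecidableEq α]

theorem powersetCard_two_triple {a b c : α} (hab : a ≠ b) (hac : a ≠ c) (hbc : b ≠ c) :
    Finset.powersetCard 2 {a, b, c} = {{a, b}, {a, c}, {b, c}} := by
  ext e
  simp only [Finset.mem_powersetCard, Finset.mem_insert, Finset.mem_singleton]
  constructor
  · rintro ⟨hs, hc⟩
    obtain ⟨x, y, hxy, rfl⟩ := Finset.card_eq_two.1 hc
    simp only [Finset.insert_subset_iff, Finset.singleton_subset_iff, Finset.mem_insert,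
      Finset.mem_singleton] at hs
    grind
  · rintro (rfl | rfl | rfl) <;> simp [Finset.insert_subset_iff, hab, hac, hbc]

/-- A nonempty set of at most three edges in which all degrees are even is a triangle. -/
theorem exists_triangle_of_even_degrees {B : Finset (Finset α)} (h2 : ∀ e ∈ B, e.card = 2)
    (heven : ∀ v, Even (B.filter (v ∈ ·)).card) (h3 : B.card ≤ 3) (hne : B.Nonempty) :
    ∃ a b c : α, B = {{a, b}, {b, c}, {c, a}} := by
  -- An even positive degree is at least two, so each end of an edge carries another edge.
  have step : ∀ e ∈ B, ∀ v ∈ e, ∃ w, w ∉ e ∧ {v, w} ∈ B := by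
    intro e he v hv
    have hmem : e ∈ B.filter (v ∈ ·) := Finset.mem_filter.2 ⟨he, hv⟩
    have hpos := Finset.card_pos.2 ⟨e, hmem⟩
    have hlt : 1 < (B.filter (v ∈ ·)).card := by
      obtain ⟨k, hk⟩ := heven v
      omega
    obtain ⟨e', he', hne'⟩ := Finset.exists_mem_ne hlt e
    obtain ⟨he'B, hve'⟩ := Finset.mem_filter.1 he'
    have h2' := h2 e' he'B
    obtain ⟨w, hw⟩ := Finset.card_eq_one.1 (show (e'.erase v).card = 1 by
      rw [Finset.card_erase_of_mem hve', h2'])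
    have he'w : e' = {v, w} := by rw [← Finset.insert_erase hve', hw]
    refine ⟨w, fun hwe => hne' ?_, he'w ▸ he'B⟩
    refine Finset.eq_of_subset_of_card_le ?_ (by rw [h2 e he, h2'])
    rw [he'w, Finset.insert_subset_iff, Finset.singleton_subset_iff]
    exact ⟨hv, hwe⟩
  obtain ⟨e, he⟩ := hne
  obtain ⟨a, b, hab, rfl⟩ := Finset.card_eq_two.1 (h2 e he)
  obtain ⟨c, hc, hac⟩ := step _ he a (by simp)
  obtain ⟨d, hd, hbd⟩ := step _ he b (by simp)
  obtain ⟨x, hx, hcx⟩ := step _ hac c (by simp)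
  simp only [Finset.mem_insert, Finset.mem_singleton, not_or] at hc hd hx
  have ne1 : ({a, b} : Finset α) ≠ {a, c} := fun h => by
    have : c ∈ ({a, b} : Finset α) := h ▸ by simp
    simp [hc] at this
  have ne2 : ({a, b} : Finset α) ≠ {b, d} := fun h => by
    have : d ∈ ({a, b} : Finset α) := h ▸ by simp
    simp [hd] at this
  have ne3 : ({a, c} : Finset α) ≠ {b, d} := fun h => by
    have : a ∈ ({b, d} : Finset α) := h ▸ by simp
    simp [hab, Ne.symm hd.1] at this
  by_cases hcd : c = d
  · subst hcd
    refine ⟨a, b, c, (Finset.eq_of_subset_of_card_le ?_ ?_).symm⟩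
    · simp only [Finset.insert_subset_iff, Finset.singleton_subset_iff]
      exact ⟨he, hbd, Finset.pair_comm a c ▸ hac⟩
    · rw [Finset.pair_comm c a, Finset.card_eq_three.2 ⟨_, _, _, ne2, ne1, ne3.symm, rfl⟩]
      exact h3
  -- If the path `d b a c` does not close up, evenness at `c` yields a fourth edge `{c, x}`.
  · exfalso
    have ne4 : ({c, x} : Finset α) ≠ {a, b} := fun h => by
      have : c ∈ ({a, b} : Finset α) := h ▸ by simp
      simp [hc] at this
    have ne5 : ({c, x} : Finset α) ≠ {a, c} := fun h => by
      have : x ∈ ({a, c} : Finset α) := h ▸ by simp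
      simp [hx] at this
    have ne6 : ({c, x} : Finset α) ≠ {b, d} := fun h => by
      have : c ∈ ({b, d} : Finset α) := h ▸ by simp
      simp [hc, hcd] at this
    have hsub : {{c, x}, {a, b}, {a, c}, {b, d}} ⊆ B := by
      simp only [Finset.insert_subset_iff, Finset.singleton_subset_iff]
      exact ⟨hcx, he, hac, hbd⟩
    have := Finset.card_le_card hsub
    rw [Finset.card_insert_of_notMem (by simp [ne4, ne5, ne6]),
      Finset.card_eq_three.2 ⟨_, _, _, ne1, ne2, ne3, rfl⟩] at this
    omega

end Combinatorics

section Counting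

variable {Δ : SimplicialComplex ℝ Plane} {Ω : Set Plane}

/-- The inner edges of `Δ`: the edges that lie on two triangles. -/
def innerEdges (Δ : SimplicialComplex ℝ Plane) : Set (Finset Plane) :=
  {e | e ∈ edges Δ ∧ ∃ s ∈ triangles Δ, ∃ t ∈ triangles Δ, s ≠ t ∧ e ⊆ s ∧ e ⊆ t}

theorem mem_boundaryEdges_or_mem_innerEdges {t e : Finset Plane} (ht : t ∈ triangles Δ)
    (het : e ⊆ t) (he : e.card = 2) : e ∈ boundaryEdges Δ ∨ e ∈ innerEdges Δ := by
  have heE := mem_edges_of_subset ht het he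
  by_cases hb : e ∈ boundaryEdges Δ
  · exact Or.inl hb
  · obtain ⟨s, hs, hts, hes⟩ := exists_ne_of_notMem_boundaryEdges heE hb ht het
    exact Or.inr ⟨heE, t, ht, s, hs, hts, het, hes⟩

theorem notMem_innerEdges_of_mem_boundaryEdges {e : Finset Plane} (he : e ∈ boundaryEdges Δ) :
    e ∉ innerEdges Δ := fun ⟨_, _, hs, _, ht, hst, hes, het⟩ =>
  hst (he.2.unique ⟨hs, hes⟩ ⟨ht, het⟩)

/-- Double counting of the incidences between the edges with a given property and the triangles. -/
theorem sum_card_powersetCard_filter [DecidableEq Plane] {T B I : Finset (Finset Plane)}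
    (hT : ∀ t, t ∈ T ↔ t ∈ triangles Δ) (hB : ∀ e, e ∈ B ↔ e ∈ boundaryEdges Δ)
    (hI : ∀ e, e ∈ I ↔ e ∈ innerEdges Δ) (P : Finset Plane → Prop) [DecidablePred P] :
    ∑ t ∈ T, ((t.powersetCard 2).filter P).card = (B.filter P).card + 2 * (I.filter P).card := by
  have hdis : Disjoint (B.filter P) (I.filter P) := by
    rw [Finset.disjoint_left]
    intro e he he'
    exact notMem_innerEdges_of_mem_boundaryEdges ((hB e).1 (Finset.mem_filter.1 he).1)
      ((hI e).1 (Finset.mem_filter.1 he').1)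
  have h := Finset.sum_card_bipartiteAbove_eq_sum_card_bipartiteBelow (s := T)
    (t := B.filter P ∪ I.filter P) (fun t e => e ⊆ t)
  rw [Finset.sum_union hdis] at h
  have hb : ∀ e ∈ B.filter P, (Finset.bipartiteBelow (fun t e => e ⊆ t) T e).card = 1 := by
    intro e he
    obtain ⟨-, t, ht, huniq⟩ := (hB e).1 (Finset.mem_filter.1 he).1
    refine Finset.card_eq_one.2 ⟨t, ?_⟩
    ext s
    simp only [Finset.mem_bipartiteBelow, Finset.mem_singleton, hT]
    exact ⟨fun hs => huniq s hs, fun hs => hs ▸ ht⟩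
  have hi : ∀ e ∈ I.filter P, (Finset.bipartiteBelow (fun t e => e ⊆ t) T e).card = 2 := by
    intro e he
    obtain ⟨heE, s, hs, t, ht, hst, hes, het⟩ := (hI e).1 (Finset.mem_filter.1 he).1
    refine Finset.card_eq_two.2 ⟨s, t, hst, ?_⟩
    ext u
    simp only [Finset.mem_bipartiteBelow, Finset.mem_insert, Finset.mem_singleton, hT]
    constructor
    · rintro ⟨hu, heu⟩
      rcases eq_or_eq_or_eq_of_edge_subset heE hu hs ht heu hes het with h | h | h
      · exact Or.inl h
      · exact Or.inr h
      · exact absurd h hst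
    · rintro (rfl | rfl)
      · exact ⟨hs, hes⟩
      · exact ⟨ht, het⟩
  rw [Finset.sum_const_nat hb, Finset.sum_const_nat hi, mul_one, mul_comm _ 2] at h
  rw [← h]
  refine Finset.sum_congr rfl fun t ht => ?_
  congr 1
  ext e
  simp only [Finset.mem_filter, Finset.mem_powersetCard, Finset.mem_bipartiteAbove,
    Finset.mem_union, hB, hI]
  constructor
  · rintro ⟨⟨het, he⟩, hP⟩
    exact ⟨(mem_boundaryEdges_or_mem_innerEdges ((hT t).1 ht) het he).imp (⟨·, hP⟩) (⟨·, hP⟩), het⟩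
  · rintro ⟨h | h, het⟩
    · exact ⟨⟨het, h.1.1.2⟩, h.2⟩
    · exact ⟨⟨het, h.1.1.2⟩, h.2⟩

theorem finite_edges (h : Δ.faces.Finite) : (edges Δ).Finite := h.subset fun _ h => h.1

theorem finite_boundaryEdges (h : Δ.faces.Finite) : (boundaryEdges Δ).Finite :=
  (finite_edges h).subset fun _ h => h.1

theorem finite_innerEdges (h : Δ.faces.Finite) : (innerEdges Δ).Finite :=
  (finite_edges h).subset fun _ h => h.1

theorem three_mul_ncard_triangles (h : Δ.faces.Finite) :
    3 * (triangles Δ).ncard = (boundaryEdges Δ).ncard + 2 * (innerEdges Δ).ncard := by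
  classical
  have := sum_card_powersetCard_filter (Δ := Δ) (T := (finite_triangles h).toFinset)
    (B := (finite_boundaryEdges h).toFinset) (I := (finite_innerEdges h).toFinset)
    (by simp) (by simp) (by simp) (fun _ => True)
  simp only [Finset.filter_true] at this
  rw [ncard_eq_toFinset_card _ (finite_triangles h),
    ncard_eq_toFinset_card _ (finite_boundaryEdges h),
    ncard_eq_toFinset_card _ (finite_innerEdges h), ← this, mul_comm]
  refine (Finset.sum_const_nat fun t ht => ?_).symm
  rw [Finset.card_powersetCard, ((finite_triangles h).mem_toFinset.1 ht).2]
  rfl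

/-- Every vertex lies on an even number of boundary edges. -/
theorem even_card_boundaryEdges_filter [DecidableEq Plane] (h : Δ.faces.Finite) (v : Plane) :
    Even ((finite_boundaryEdges h).toFinset.filter (v ∈ ·)).card := by
  -- Each triangle has zero or two sides through `v`, and inner edges are counted twice, so the
  -- boundary edges through `v` are even in number.
  have := sum_card_powersetCard_filter (Δ := Δ) (T := (finite_triangles h).toFinset)
    (B := (finite_boundaryEdges h).toFinset) (I := (finite_innerEdges h).toFinset)
    (by simp) (by simp) (by simp) (v ∈ ·)
  have hs : Even (∑ t ∈ (finite_triangles h).toFinset,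
      ((t.powersetCard 2).filter (v ∈ ·)).card) := by
    refine Finset.even_sum _ fun t ht => ?_
    have ht := (finite_triangles h).mem_toFinset.1 ht
    by_cases hv : v ∈ t
    · obtain ⟨a, ha, hav⟩ := Finset.exists_mem_ne (show 1 < t.card by rw [ht.2]; norm_num) v
      obtain ⟨b, hvb, hab, rfl⟩ := exists_third ht.2 hav.symm hv ha
      rw [powersetCard_two_triple hav.symm hvb hab]
      have h1 : v ∉ ({a, b} : Finset Plane) := by simp [hav.symm, hvb]
      have h2 : ({v, a} : Finset Plane) ≠ {v, b} := fun h => by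
        have : a ∈ ({v, b} : Finset Plane) := h ▸ by simp
        simp [hav, hab] at this
      rw [Finset.filter_insert, Finset.filter_insert, Finset.filter_singleton, if_pos (by simp),
        if_pos (by simp), if_neg h1]
      simp [h2]
    · rw [Finset.filter_eq_empty_iff.2 fun e he hve => hv ((Finset.mem_powersetCard.1 he).1 hve)]
      simp
  rw [this] at hs
  exact (Nat.even_add.1 hs).2 (even_two_mul _)

/-- An inner edge is the intersection of its two triangles, so it is determined by the corresponding
edge of the dual graph. -/
theorem ncard_innerEdges_le (h : Δ.faces.Finite) :
    (innerEdges Δ).ncard ≤ (dualGraph Δ).edgeSet.ncard := by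
  classical
  have := (finite_triangles h).to_subtype
  have hc : ∀ e : innerEdges Δ, ∃ s t : triangles Δ, s.1 ≠ t.1 ∧ e.1 ⊆ s.1 ∧ e.1 ⊆ t.1 := by
    rintro ⟨e, -, s, hs, t, ht, h⟩
    exact ⟨⟨s, hs⟩, ⟨t, ht⟩, h⟩
  choose s t hst hs ht using hc
  rw [← Nat.card_coe_set_eq, ← Nat.card_coe_set_eq]
  refine Nat.card_le_card_of_injective (fun e => (⟨s(s e, t e), (SimpleGraph.mem_edgeSet _).2
    ⟨fun h => hst e (by rw [h]), e.1, e.2.1, hs e, ht e⟩⟩ : (dualGraph Δ).edgeSet)) ?_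
  have key : ∀ e, e.1 = (s e).1 ∩ (t e).1 := fun e => by
    refine Finset.eq_of_subset_of_card_le (Finset.subset_inter (hs e) (ht e)) ?_
    rw [e.2.1.2]
    by_contra! hlt
    have h3 := (s e).2.2
    have h1 := Finset.eq_of_subset_of_card_le (Finset.inter_subset_left (s₁ := (s e).1)
      (s₂ := (t e).1)) (by omega)
    have h3' := (t e).2.2
    have h2 := Finset.eq_of_subset_of_card_le (Finset.inter_subset_right (s₁ := (s e).1)
      (s₂ := (t e).1)) (by omega)
    exact hst e (h1.symm.trans h2)
  intro e e' hee
  simp only [Subtype.mk.injEq, Sym2.eq_iff] at hee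
  apply Subtype.ext
  rw [key e, key e']
  rcases hee with ⟨h1, h2⟩ | ⟨h1, h2⟩
  · rw [h1, h2]
  · rw [h1, h2, Finset.inter_comm]

end Counting

/-! ### The number of bounded faces -/

section Euler

variable {Δ : SimplicialComplex ℝ Plane} {Ω : Set Plane}

open Classical in
/-- The incidence matrix of triangles and inner edges over `ZMod 2`. -/
noncomputable def incidence (Δ : SimplicialComplex ℝ Plane) :
    Matrix (triangles Δ) (innerEdges Δ) (ZMod 2) :=
  Matrix.of fun t e => if e.1 ⊆ t.1 then 1 else 0

open Classical in
/-- The function on the points of the plane given by a function on the bounded faces of the dual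
graph. -/
noncomputable def faceValue (Δ : SimplicialComplex ℝ Plane) :
    (dualBoundedFaces Δ → ZMod 2) →ₗ[ZMod 2] Plane → ZMod 2 where
  -- The default 0 on unbounded faces is the normalisation that later makes the coboundary
  -- injective.
  toFun φ x := if h : faceAt Δ x ∈ dualBoundedFaces Δ then φ ⟨_, h⟩ else 0
  map_add' φ ψ := by
    funext x
    by_cases h : faceAt Δ x ∈ dualBoundedFaces Δ <;> simp [h]
  map_smul' r φ := by
    funext x
    by_cases h : faceAt Δ x ∈ dualBoundedFaces Δ <;> simp [h]

theorem faceValue_eq_zero (φ : dualBoundedFaces Δ → ZMod 2) {x : Plane}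
    (h : faceAt Δ x ∉ dualBoundedFaces Δ) : faceValue Δ φ x = 0 := by
  simp [faceValue, h]

theorem faceValue_of_mem (φ : dualBoundedFaces Δ → ZMod 2) {x : Plane} {F : dualBoundedFaces Δ}
    (h : faceAt Δ x = F) : faceValue Δ φ x = φ F := by
  obtain ⟨F, hF⟩ := F
  subst h
  simp [faceValue, hF]

theorem faceValue_congr (φ : dualBoundedFaces Δ → ZMod 2) {x y : Plane}
    (h : faceAt Δ x = faceAt Δ y) : faceValue Δ φ x = faceValue Δ φ y := by
  by_cases hy : faceAt Δ y ∈ dualBoundedFaces Δ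
  · rw [faceValue_of_mem φ (F := ⟨_, hy⟩) h, faceValue_of_mem φ (F := ⟨_, hy⟩) rfl]
  · rw [faceValue_eq_zero φ hy, faceValue_eq_zero φ (h ▸ hy)]

/-- The coboundary of a function on the bounded faces. -/
noncomputable def faceCoboundary (Δ : SimplicialComplex ℝ Plane) :
    (dualBoundedFaces Δ → ZMod 2) →ₗ[ZMod 2] innerEdges Δ → ZMod 2 where
  toFun φ e := ∑ x ∈ e.1, faceValue Δ φ x
  map_add' φ ψ := by
    funext e
    simp [Finset.sum_add_distrib]
  map_smul' r φ := by
    funext e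
    simp [Finset.mul_sum]

theorem faceValue_sum_boundaryEdge (φ : dualBoundedFaces Δ → ZMod 2) {e : Finset Plane}
    (he : e ∈ boundaryEdges Δ) : ∑ x ∈ e, faceValue Δ φ x = 0 := by
  classical
  obtain ⟨a, b, hab, rfl⟩ := exists_pair_of_mem_edges he.1
  rw [Finset.sum_pair hab, faceValue_congr φ (faceAt_eq_of_boundaryEdge he),
    CharTwo.add_self_eq_zero]

/-- Around a triangle each vertex value occurs in two sides and cancels modulo 2. Boundary sides,
absent from the matrix, contribute zero because their ends share a face. -/
theorem incidence_mulVec_faceCoboundary [Fintype (innerEdges Δ)]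
    (φ : dualBoundedFaces Δ → ZMod 2) : (incidence Δ).mulVec (faceCoboundary Δ φ) = 0 := by
  classical
  funext t
  set f : Finset Plane → ZMod 2 := fun e => ∑ x ∈ e, faceValue Δ φ x with hf
  have h1 : (incidence Δ).mulVec (faceCoboundary Δ φ) t =
      ∑ e : innerEdges Δ, if e.1 ⊆ t.1 then f e.1 else 0 := by
    simp only [Matrix.mulVec, dotProduct, incidence, Matrix.of_apply, ite_mul, one_mul, zero_mul]
    rfl
  have h2 : ∑ e : innerEdges Δ, (if e.1 ⊆ t.1 then f e.1 else 0) =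
      ∑ e ∈ (innerEdges Δ).toFinset, if e ⊆ t.1 then f e else 0 :=
    (Finset.sum_subtype _ (fun e => mem_toFinset) fun e => if e ⊆ t.1 then f e else 0).symm
  have h3 : ∑ e ∈ (innerEdges Δ).toFinset, (if e ⊆ t.1 then f e else 0) =
      ∑ e ∈ t.1.powersetCard 2, f e := by
    rw [← Finset.sum_filter]
    refine Finset.sum_subset (fun e he => ?_) fun e he he' => ?_
    · obtain ⟨he, het⟩ := Finset.mem_filter.1 he
      exact Finset.mem_powersetCard.2 ⟨het, (mem_toFinset.1 he).1.2⟩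
    · obtain ⟨het, hc⟩ := Finset.mem_powersetCard.1 he
      rcases mem_boundaryEdges_or_mem_innerEdges t.2 het hc with h | h
      · exact faceValue_sum_boundaryEdge φ h
      · exact absurd (Finset.mem_filter.2 ⟨mem_toFinset.2 h, het⟩) he'
  rw [h1, h2, h3]
  obtain ⟨a, b, c, hab, hac, hbc, ht⟩ := Finset.card_eq_three.1 t.2.2
  have n1 : ({a, b} : Finset Plane) ∉ ({{a, c}, {b, c}} : Finset (Finset Plane)) := by
    have hm : c ∉ ({a, b} : Finset Plane) := by simp [hac.symm, hbc.symm]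
    simp only [Finset.mem_insert, Finset.mem_singleton, not_or]
    exact ⟨fun h => hm (h ▸ by simp), fun h => hm (h ▸ by simp)⟩
  have n2 : ({a, c} : Finset Plane) ≠ {b, c} := fun h => by
    have : a ∈ ({b, c} : Finset Plane) := h ▸ by simp
    simp [hab, hac] at this
  rw [ht, powersetCard_two_triple hab hac hbc, Finset.sum_insert n1, Finset.sum_pair n2]
  simp only [hf, Finset.sum_pair hab, Finset.sum_pair hac, Finset.sum_pair hbc, Pi.zero_apply]
  have two : (2 : ZMod 2) = 0 := rfl
  linear_combination (faceValue Δ φ a + faceValue Δ φ b + faceValue Δ φ c) * two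

/-- A vanishing coboundary makes the vertex values constant on each triangle, hence everywhere by
dual connectedness. The constant is 0 because of a vertex in an unbounded face, and every bounded
face contains a vertex. -/
theorem faceCoboundary_injective (hΔ : IsTriangulationOf Δ Ω) :
    Function.Injective (faceCoboundary Δ) := by
  classical
  rw [← LinearMap.ker_eq_bot, LinearMap.ker_eq_bot']
  intro φ hφ
  have hedge : ∀ t ∈ triangles Δ, ∀ x ∈ t, ∀ y ∈ t, faceValue Δ φ x = faceValue Δ φ y := by
    intro t ht x hx y hy
    by_cases hxy : x = y
    · rw [hxy]
    have hsub : {x, y} ⊆ t := by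
      simp only [Finset.insert_subset_iff, Finset.singleton_subset_iff]
      exact ⟨hx, hy⟩
    rcases mem_boundaryEdges_or_mem_innerEdges ht hsub (Finset.card_pair hxy) with h | h
    · exact faceValue_congr φ (faceAt_eq_of_boundaryEdge h)
    · have : ∑ z ∈ ({x, y} : Finset Plane), faceValue Δ φ z = 0 := congrFun hφ ⟨_, h⟩
      rw [Finset.sum_pair hxy] at this
      exact CharTwo.add_eq_zero.1 this
  obtain ⟨v, hv, hvF⟩ := exists_vertex_unbounded hΔ
  obtain ⟨t, ht, hvt⟩ := exists_triangle_of_mem_vertices hΔ hv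
  have hall := dual_connected hΔ (S := {s | s ∈ triangles Δ ∧ ∀ x ∈ s, faceValue Δ φ x = 0})
    (fun s hs => hs.1)
    ⟨t, ht, fun x hx => (hedge t ht x hx v hvt).trans (faceValue_eq_zero φ hvF)⟩ (by
      rintro s ⟨hs, hs0⟩ s' hs' e he hes hes'
      obtain ⟨x, hx⟩ := SimplicialComplex.nonempty_of_mem_faces he.1
      exact ⟨hs', fun y hy => (hedge s' hs' y hy x (hes' hx)).trans (hs0 x (hes hx))⟩)
  funext F
  obtain ⟨p, hp, hF⟩ := F.2.2
  obtain ⟨u, hu, hpu⟩ := exists_vertex_of_face hΔ hp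
  obtain ⟨s, hs, hus⟩ := exists_triangle_of_mem_vertices hΔ hu
  rw [← faceValue_of_mem φ (hpu.symm.trans hF.symm)]
  exact (hall hs).2 u hus

/-- A vector in the kernel of the transpose takes equal values on triangles sharing an edge, so it
is constant; the left kernel has dimension at most one. -/
theorem card_triangles_le_rank_incidence [Fintype (triangles Δ)] [Fintype (innerEdges Δ)]
    (hΔ : IsTriangulationOf Δ Ω) :
    Fintype.card (triangles Δ) ≤ (incidence Δ).rank + 1 := by
  classical
  obtain ⟨t₀, ht₀⟩ := nonempty_triangles hΔ
  have hker : (incidence Δ).transpose.mulVecLin.ker ≤ Submodule.span (ZMod 2) {1} := by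
    intro g hg
    rw [Submodule.mem_span_singleton]
    refine ⟨g ⟨t₀, ht₀⟩, ?_⟩
    have hall := dual_connected hΔ
      (S := {s | ∃ hs : s ∈ triangles Δ, g ⟨s, hs⟩ = g ⟨t₀, ht₀⟩}) (fun s hs => hs.1)
      ⟨t₀, ht₀, rfl⟩ (by
        rintro s ⟨hs, hgs⟩ t ht e he hes het
        refine ⟨ht, ?_⟩
        by_cases hst : s = t
        · subst hst
          exact hgs
        rw [← hgs]
        have h0 := congrFun (LinearMap.mem_ker.1 hg) ⟨e, he, s, hs, t, ht, hst, hes, het⟩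
        simp only [Matrix.mulVecLin_apply, Matrix.mulVec, dotProduct, Matrix.transpose_apply,
          incidence, Matrix.of_apply, ite_mul, one_mul, zero_mul, Pi.zero_apply] at h0
        rw [← Finset.sum_filter] at h0
        have hfil : Finset.univ.filter (fun u : triangles Δ => e ⊆ u.1) =
            {⟨s, hs⟩, ⟨t, ht⟩} := by
          ext u
          simp only [Finset.mem_filter, Finset.mem_univ, true_and, Finset.mem_insert,
            Finset.mem_singleton]
          constructor
          · intro hu
            rcases eq_or_eq_or_eq_of_edge_subset he u.2 hs ht hu hes het with h | h | h
            · exact Or.inl (Subtype.ext h)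
            · exact Or.inr (Subtype.ext h)
            · exact absurd h hst
          · rintro (rfl | rfl)
            · exact hes
            · exact het
        rw [hfil, Finset.sum_pair (fun h => hst (congrArg Subtype.val h))] at h0
        exact (CharTwo.add_eq_zero.1 h0).symm)
    funext t
    obtain ⟨_, h⟩ := hall t.2
    simpa using h.symm
  have h1 := Submodule.finrank_mono hker
  have h2 : Module.finrank (ZMod 2) (Submodule.span (ZMod 2) {(1 : triangles Δ → ZMod 2)}) ≤ 1 :=
    (finrank_span_le_card _).trans (by simp)
  have h3 := LinearMap.finrank_range_add_finrank_ker (incidence Δ).transpose.mulVecLin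
  rw [Module.finrank_fintype_fun_eq_card] at h3
  rw [← Matrix.rank_transpose, Matrix.rank]
  omega

/-- The easy half of Euler's formula for the dual graph. -/
theorem ncard_faces_add_ncard_triangles_le (hΔ : IsTriangulationOf Δ Ω) :
    (dualBoundedFaces Δ).ncard + (triangles Δ).ncard ≤ (innerEdges Δ).ncard + 1 := by
  classical
  have := (finite_triangles hΔ.finite_faces).fintype
  have := (finite_innerEdges hΔ.finite_faces).fintype
  have := (finite_dualBoundedFaces hΔ).fintype
  rw [← Nat.card_coe_set_eq, ← Nat.card_coe_set_eq, ← Nat.card_coe_set_eq,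
    Nat.card_eq_fintype_card, Nat.card_eq_fintype_card, Nat.card_eq_fintype_card]
  -- f ≤ dim ker = I - rank, while rank ≥ T - 1.
  have h1 := card_triangles_le_rank_incidence hΔ
  have h2 := LinearMap.finrank_range_add_finrank_ker (incidence Δ).mulVecLin
  rw [Module.finrank_fintype_fun_eq_card] at h2
  have h3 := LinearMap.finrank_le_finrank_of_injective
    (f := (faceCoboundary Δ).codRestrict (incidence Δ).mulVecLin.ker fun φ =>
      LinearMap.mem_ker.2 (incidence_mulVec_faceCoboundary φ))
    (fun φ ψ h => faceCoboundary_injective hΔ (congrArg Subtype.val h))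
  rw [Module.finrank_fintype_fun_eq_card] at h3
  rw [Matrix.rank] at h1
  omega

end Euler

/-! ### The conclusion -/

section Conclusion

variable {Δ : SimplicialComplex ℝ Plane} {Ω : Set Plane}

/-- Without boundary edges the complex would contain the whole plane, although it is bounded. -/
theorem nonempty_boundaryEdges (hΔ : IsTriangulationOf Δ Ω) : (boundaryEdges Δ).Nonempty := by
  by_contra hne
  rw [not_nonempty_iff_eq_empty] at hne
  obtain ⟨x, hx⟩ := hΔ.isConnected.nonempty
  have h := subset_space_of_disjoint_boundaryEdges hΔ isOpen_univ isPreconnected_univ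
    (by simp [hne]) ⟨x, mem_univ x, hΔ.space_eq ▸ subset_closure hx⟩
  exact NormedSpace.unbounded_univ ℝ Plane ((isBounded_space hΔ).subset h)

theorem exists_boundary_triangle [DecidableEq Plane] (hΔ : IsTriangulationOf Δ Ω)
    (hG : DualContractible Δ) :
    ∃ a b c : Plane, ∀ e, e ∈ boundaryEdges Δ ↔ e = {a, b} ∨ e = {b, c} ∨ e = {c, a} := by
  have h1 := ncard_faces_add_ncard_triangles_le hΔ
  have h2 := three_mul_ncard_triangles hΔ.finite_faces
  have h3 := ncard_innerEdges_le hΔ.finite_faces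
  -- I ≤ e ≤ 3f ≤ 3(I + 1 - T) = I + 3 - B, using 3T = B + 2I.
  have hle : (boundaryEdges Δ).ncard ≤ 3 := by
    unfold DualContractible at hG
    omega
  have hfin := finite_boundaryEdges hΔ.finite_faces
  rw [ncard_eq_toFinset_card _ hfin] at hle
  obtain ⟨a, b, c, h⟩ := exists_triangle_of_even_degrees
    (fun e he => (hfin.mem_toFinset.1 he).1.2)
    (even_card_boundaryEdges_filter hΔ.finite_faces) hle
    (hfin.toFinset_nonempty.2 (nonempty_boundaryEdges hΔ))
  refine ⟨a, b, c, fun e => ?_⟩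
  rw [← hfin.mem_toFinset, h]
  simp

/-- A vertex on an edge is an end of that edge. -/
theorem eq_or_eq_of_wbtw [DecidableEq Plane] {x y z : Plane} (hy : y ∈ Δ.vertices)
    (hxz : {x, z} ∈ edges Δ) (h : Wbtw ℝ x y z) : y = x ∨ y = z := by
  have := (SimplicialComplex.vertex_mem_convexHull_iff hy hxz.1).1 (by
    rw [Finset.coe_pair, convexHull_pair]
    exact mem_segment_iff_wbtw.2 h)
  simpa using this

/-- Among collinear points one lies between the other two, hence on an edge of the complex; being a
vertex, it would be an end of that edge. -/
theorem affineIndependent_of_edges [DecidableEq Plane] {a b c : Plane} (hab : {a, b} ∈ edges Δ)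
    (hbc : {b, c} ∈ edges Δ) (hca : {c, a} ∈ edges Δ) : AffineIndependent ℝ ![a, b, c] := by
  have ne : ∀ {x y : Plane}, {x, y} ∈ edges Δ → x ≠ y := fun h hxy => by
    have := h.2
    simp [hxy] at this
  have hva := mem_vertices_of_mem hab.1 (x := a) (by simp)
  have hvb := mem_vertices_of_mem hab.1 (x := b) (by simp)
  have hvc := mem_vertices_of_mem hbc.1 (x := c) (by simp)
  rw [affineIndependent_iff_not_collinear_set]
  intro h
  rcases h.wbtw_or_wbtw_or_wbtw with h | h | h
  · rcases eq_or_eq_of_wbtw hvb (Finset.pair_comm c a ▸ hca) h with h | h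
    · exact ne hab h.symm
    · exact ne hbc h
  · rcases eq_or_eq_of_wbtw hvc (Finset.pair_comm a b ▸ hab) h with h | h
    · exact ne hbc h.symm
    · exact ne hca h
  · rcases eq_or_eq_of_wbtw hva (Finset.pair_comm b c ▸ hbc) h with h | h
    · exact ne hca h.symm
    · exact ne hab h

/-- A convex set containing the boundary edges contains the complex. -/
theorem space_subset_of_boundaryEdges (hΔ : IsTriangulationOf Δ Ω) {C : Set Plane}
    (hC : Convex ℝ C) (hCc : IsClosed C)
    (hb : ∀ e ∈ boundaryEdges Δ, convexHull ℝ (e : Set Plane) ⊆ C) (hne : C.Nonempty) :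
    Δ.space ⊆ C := by
  intro p hp
  by_contra hpC
  -- The open half plane beyond a separating line avoids the boundary edges but meets the complex,
  -- so the bounded complex would contain it.
  obtain ⟨f, u, hfC, hfp⟩ := geometric_hahn_banach_closed_point hC hCc hpC
  have hU : IsOpen {x | u < f x} := isOpen_lt continuous_const f.continuous
  have hsub := subset_space_of_disjoint_boundaryEdges hΔ hU
    (convex_halfSpace_gt (f : Plane →ₗ[ℝ] ℝ).isLinear u).isPreconnected
    (fun e he => disjoint_left.2 fun x hx hxe => (hfC x (hb e he hxe)).not_gt hx) ⟨p, hfp, hp⟩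
  obtain ⟨q, hq⟩ := hne
  have hpos : 0 < f (p - q) := by
    rw [map_sub]
    linarith [hfC q hq]
  obtain ⟨M, hM⟩ := (isBounded_space hΔ).exists_norm_le
  have hpq : 0 < ‖p - q‖ := norm_pos_iff.2 fun h => by simp [h] at hpos
  -- Chosen so that moving from `p` by `r • (p - q)`, a direction in which `f` increases, leaves the
  -- ball of radius `M`.
  set r := (|M| + ‖p‖ + 1) / ‖p - q‖ with hr
  have hr0 : 0 ≤ r := by positivity
  have hmem : p + r • (p - q) ∈ {x | u < f x} := by
    change u < f (p + r • (p - q))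
    rw [map_add, map_smul, smul_eq_mul]
    have := mul_nonneg hr0 hpos.le
    linarith
  have h1 := hM _ (hsub hmem)
  have h2 : ‖r • (p - q)‖ = |M| + ‖p‖ + 1 := by
    rw [norm_smul, Real.norm_of_nonneg hr0, hr, div_mul_cancel₀ _ hpq.ne']
  have h3 : ‖r • (p - q)‖ ≤ ‖p + r • (p - q)‖ + ‖p‖ := by
    calc ‖r • (p - q)‖ = ‖(p + r • (p - q)) - p‖ := by rw [add_sub_cancel_left]
      _ ≤ _ := norm_sub_le _ _
  have := le_abs_self M
  linarith

/-- A triangulation whose boundary edges are the sides of a triangle fills this triangle. -/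
theorem space_eq_triangle [DecidableEq Plane] (hΔ : IsTriangulationOf Δ Ω) {a b c : Plane}
    (hi : AffineIndependent ℝ ![a, b, c])
    (hb : ∀ e, e ∈ boundaryEdges Δ ↔ e = {a, b} ∨ e = {b, c} ∨ e = {c, a}) :
    Δ.space = convexHull ℝ {a, b, c} := by
  have hD := cross_ne_zero hi
  have hcl : IsClosed (convexHull ℝ ({a, b, c} : Set Plane)) :=
    (toFinite _).isClosed_convexHull ℝ
  have hsub : Δ.space ⊆ convexHull ℝ {a, b, c} := by
    refine space_subset_of_boundaryEdges hΔ (convex_convexHull ℝ _) hcl ?_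
      ⟨a, subset_convexHull ℝ _ (by simp)⟩
    intro e he
    refine convexHull_mono ?_
    rcases (hb e).1 he with rfl | rfl | rfl <;> rw [Finset.coe_pair] <;>
      intro x <;> simp <;> tauto
  refine hsub.antisymm ?_
  have hconv := convex_convexHull ℝ ({a, b, c} : Set Plane)
  have hclosure : closure (interior (convexHull ℝ ({a, b, c} : Set Plane))) =
      convexHull ℝ {a, b, c} := by
    have hne : (interior (convexHull ℝ ({a, b, c} : Set Plane))).Nonempty :=
      ⟨_, mem_interior_triangle hD (α := 1 / 3) (β := 1 / 3) (γ := 1 / 3) (by norm_num)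
        (by norm_num) (by norm_num) (by norm_num)⟩
    rw [hconv.closure_interior_eq_closure_of_nonempty_interior hne, hcl.closure_eq]
  have hline : ∀ x y z : Plane, cross x y z = cross a b c →
      (∀ q ∈ convexHull ℝ {a, b, c}, 0 ≤ cross x y q * cross a b c) →
      Disjoint (interior (convexHull ℝ ({a, b, c} : Set Plane))) (convexHull ℝ {x, y}) := by
    intro x y z hz hq
    refine disjoint_left.2 fun p hp hpxy => ?_
    rw [convexHull_pair] at hpxy
    obtain ⟨u, v, -, -, huv, rfl⟩ := hpxy
    -- The point is pushed slightly away from `z`: it stays in the triangle, being near an interior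
    -- point, yet crosses to the wrong side of the line `x y`.
    have hlim : Tendsto (fun r : ℝ => (u + r * u) • x + (v + r * v) • y + (-r) • z) (𝓝[>] 0)
        (𝓝 (u • x + v • y)) := by
      have : Continuous (fun r : ℝ => (u + r * u) • x + (v + r * v) • y + (-r) • z) := by fun_prop
      simpa using (this.tendsto 0).mono_left (nhdsWithin_le_nhds (s := Ioi 0))
    obtain ⟨r, h1, hr⟩ := ((hlim.eventually (mem_interior_iff_mem_nhds.1 hp)).and
      self_mem_nhdsWithin).exists
    have hr : 0 < r := hr
    have h2 := hq _ h1
    rw [cross_comb (by linear_combination (1 + r) * huv), cross_left, cross_right, hz] at h2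
    nlinarith [mul_pos hr (mul_self_pos.2 hD)]
  have hU : interior (convexHull ℝ ({a, b, c} : Set Plane)) ⊆ Δ.space := by
    refine subset_space_of_disjoint_boundaryEdges hΔ isOpen_interior
      hconv.interior.isPreconnected (fun e he => ?_) ?_
    · rcases (hb e).1 he with rfl | rfl | rfl <;> rw [Finset.coe_pair]
      · exact hline a b c rfl fun q hq => ((mem_convexHull_iff_cross hD).1 hq).1
      · exact hline b c a (cross_rotate a b c) fun q hq => ((mem_convexHull_iff_cross hD).1 hq).2.1
      · exact hline c a b (cross_rotate' a b c) fun q hq => ((mem_convexHull_iff_cross hD).1 hq).2.2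
    · obtain ⟨t, ht⟩ := nonempty_triangles hΔ
      have hts := SimplicialComplex.convexHull_subset_space ht.1
      have hi := mem_interior_space_of_triangle ht (isBary_barycenter
        (SimplicialComplex.nonempty_of_mem_faces ht.1)) (fun x hx => by simp [hx, ht.2])
      exact ⟨_, interior_mono (hts.trans hsub) hi, hts (interior_subset hi)⟩
  rw [← hclosure]
  exact closure_minimal hU (isClosed_space hΔ)

end Conclusion
end PlanarTriangulation

theorem mainTheorem10
    (Δ : Geometry.SimplicialComplex ℝ PlanarTriangulation.Plane)
    (Ω : Set PlanarTriangulation.Plane)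
    (hΔ : PlanarTriangulation.IsTriangulationOf Δ Ω)
    (hG : PlanarTriangulation.DualContractible Δ) :
    PlanarTriangulation.IsSubdividedTriangle Δ := by
  classical
  obtain ⟨a, b, c, hb⟩ := PlanarTriangulation.exists_boundary_triangle hΔ hG
  have hi := PlanarTriangulation.affineIndependent_of_edges ((hb _).2 (Or.inl rfl)).1
    ((hb _).2 (Or.inr (Or.inl rfl))).1 ((hb _).2 (Or.inr (Or.inr rfl))).1
  refine ⟨a, b, c, hi, fun e => ?_, PlanarTriangulation.space_eq_triangle hΔ hi hb⟩
  rw [hb]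
  simp only [← Finset.coe_pair, Finset.coe_inj]
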